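/- Let $\Delta=\{|z|<1\}$ be the open unit disc. Let $D\subset\mathbb C$ be a bounded simply connected domain whose boundary $\partial D$ is a (simple) closed analytic curve, that is, $\partial D=k(\partial\Delta)$ where $k$ is analytic and conformal in a neighbourhood of $\partial\Delta$ and injective on $\partial\Delta$ (for example, $\partial D$ an ellipse). Let $L^2(\partial D)$ be the $L^2$ space of the normalized arc length measure $|d\zeta|/2\pi$ on $\partial D$. Let $H^2$ be the space of functions $f(z)=\sum_{n\ge 0}a_nz^n$ on $\Delta$ with norm $\|f\|=\bigl(\sum_{n\ge 0}|a_n|^2\bigr)^{1/2}<\infty$. For a conformal map $\varphi$ of $D$ onto $\Delta$ and an analytic branch $\varphi'^{1/2}$ of the square root of $\varphi'$, the Smirnov class $E^2(D)$ consists of the functions $g=(f\circ\varphi)\,\varphi'^{1/2}$ on $D$ with $f\in H^2$, with norm $\|g\|_{E^2(D)}=\|f\|_{H^2}$. Then, for every choice of $\varphi$ and of the branch, the Cauchy integral $$C_D f(z)=\frac1{2\pi i}\int_{\partial D}\frac{f(\zeta)}{\zeta-z}\,d\zeta\qquad(z\in D)$$ (the integral taken along $k$) converges absolutely for all $f\in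 L^2(\partial D)$ and $z\in D$, and $f\mapsto C_Df$ is a continuous (bounded) linear operator from $L^2(\partial D)$ into $E^2(D)$. -/

import Mathlib

open MeasureTheory Metric Set

noncomputable section

/-! ### The Hardy space of the unit disc -/

/-- The Hardy space `H²` of the unit disc, with `f(z) = ∑ aₙ zⁿ` recorded by its square-summable
sequence of Taylor coefficients, so that `‖f‖ = (∑ |aₙ|²) ^ (1/2)`. -/
abbrev HardySpace : Type := lp (fun _ : ℕ => ℂ) 2

/-- The analytic function `z ↦ ∑ aₙ zⁿ` on the unit disc given by an element of `H²`. -/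
def HardySpace.eval (f : HardySpace) (z : ℂ) : ℂ := ∑' n : ℕ, f n * z ^ n

theorem HardySpace.hasSum_eval (f : HardySpace) {z : ℂ} (hz : z ∈ ball (0 : ℂ) 1) :
    HasSum (fun n : ℕ => f n * z ^ n) (f.eval z) := by
  refine Summable.hasSum ?_
  have hz' : ‖z‖ < 1 := by simpa using hz
  refine Summable.of_norm_bounded (g := fun n : ℕ => ‖f‖ * ‖z‖ ^ n)
    ((summable_geometric_of_lt_one (norm_nonneg z) hz').mul_left _) fun n => ?_
  rw [norm_mul, norm_pow]
  exact mul_le_mul_of_nonneg_right (lp.norm_apply_le_norm (by simp) f n) (by positivity)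

theorem HardySpace.eq_zero_of_eval_eq_zero {f : HardySpace}
    (hf : ∀ z ∈ ball (0 : ℂ) 1, f.eval z = 0) : f = 0 := by
  have h : HasFPowerSeriesAt f.eval (FormalMultilinearSeries.ofScalars ℂ fun n => f n) 0 := by
    rw [hasFPowerSeriesAt_iff]
    filter_upwards [ball_mem_nhds (0 : ℂ) one_pos] with z hz
    simpa [mul_comm, FormalMultilinearSeries.coeff_ofScalars] using f.hasSum_eval hz
  have h0 : FormalMultilinearSeries.ofScalars ℂ (fun n => f n) = 0 := by
    refine h.eq_zero_of_eventually ?_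
    filter_upwards [ball_mem_nhds (0 : ℂ) one_pos] with z hz
    exact hf z hz
  ext n
  have := congrArg (fun p => FormalMultilinearSeries.coeff p n) h0
  rw [FormalMultilinearSeries.coeff_ofScalars] at this
  rw [this]
  exact FormalMultilinearSeries.coeff_eq_zero.2 rfl

/-! ### Smirnov classes -/

/-- A conformal map of `D` onto the open unit disc (a Riemann mapping function), together with an
analytic branch of the square root of its derivative. -/
structure RiemannMap (D : Set ℂ) where
  /-- the conformal map `φ` -/
  toFun : ℂ → ℂ
  /-- the branch `φ' ^ (1/2)` -/
  sqrtDeriv : ℂ → ℂ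
  differentiableOn : DifferentiableOn ℂ toFun D
  bijOn : BijOn toFun D (ball 0 1)
  deriv_ne_zero : ∀ z ∈ D, deriv toFun z ≠ 0
  differentiableOn_sqrtDeriv : DifferentiableOn ℂ sqrtDeriv D
  sq_sqrtDeriv : ∀ z ∈ D, sqrtDeriv z ^ 2 = deriv toFun z

variable {D : Set ℂ}

/-- The map `f ↦ (f ∘ φ) φ' ^ (1/2)` from `H²` to functions on `D`. -/
def RiemannMap.pullback (φ : RiemannMap D) : HardySpace →ₗ[ℂ] (D → ℂ) where
  toFun f z := f.eval (φ.toFun z) * φ.sqrtDeriv z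
  map_add' f g := by
    funext z
    have hz := φ.bijOn.mapsTo z.2
    have h : (f + g).eval (φ.toFun z) = f.eval (φ.toFun z) + g.eval (φ.toFun z) := by
      refine ((f + g).hasSum_eval hz).unique ?_
      simpa [add_mul] using (f.hasSum_eval hz).add (g.hasSum_eval hz)
    simp [h, add_mul]
  map_smul' c f := by
    funext z
    have hz := φ.bijOn.mapsTo z.2
    have h : (c • f).eval (φ.toFun z) = c * f.eval (φ.toFun z) := by
      refine ((c • f).hasSum_eval hz).unique ?_
      simpa [mul_assoc] using (f.hasSum_eval hz).mul_left c
    simp [h, mul_assoc]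

theorem RiemannMap.pullback_injective (φ : RiemannMap D) : Function.Injective φ.pullback := by
  refine (injective_iff_map_eq_zero _).2 fun f hf => HardySpace.eq_zero_of_eval_eq_zero fun w hw => ?_
  obtain ⟨z, hz, rfl⟩ := φ.bijOn.surjOn hw
  have h : f.eval (φ.toFun z) * φ.sqrtDeriv z = 0 := congrFun hf ⟨z, hz⟩
  refine (mul_eq_zero.1 h).resolve_right fun hs => φ.deriv_ne_zero z hz ?_
  rw [← φ.sq_sqrtDeriv z hz, hs]
  simp

/-- The Smirnov class `E²(D)`: all functions on `D` of the form `(f ∘ φ) φ' ^ (1/2)`, `f ∈ H²`. -/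
def SmirnovClass (φ : RiemannMap D) : Type := LinearMap.range φ.pullback

namespace SmirnovClass

variable {φ : RiemannMap D}

instance : AddCommGroup (SmirnovClass φ) :=
  inferInstanceAs (AddCommGroup (LinearMap.range φ.pullback))

instance : Module ℂ (SmirnovClass φ) :=
  inferInstanceAs (Module ℂ (LinearMap.range φ.pullback))

instance : CoeFun (SmirnovClass φ) (fun _ => D → ℂ) := ⟨fun g => g.1⟩

variable (φ) in
/-- The bijection `f ↦ (f ∘ φ) φ' ^ (1/2)` of `H²` onto `E²(D)`. -/
def ofHardy : HardySpace ≃ₗ[ℂ] SmirnovClass φ :=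
  LinearEquiv.ofInjective φ.pullback φ.pullback_injective

/-- The norm of `E²(D)`: the norm in `H²` of `f`, where `g = (f ∘ φ) φ' ^ (1/2)`. -/
instance : NormedAddCommGroup (SmirnovClass φ) :=
  NormedAddCommGroup.induced _ _ (ofHardy φ).symm (ofHardy φ).symm.injective

instance : NormedSpace ℂ (SmirnovClass φ) :=
  NormedSpace.induced ℂ _ _ (ofHardy φ).symm

theorem ofHardy_apply (f : HardySpace) (z : D) :
    ofHardy φ f z = f.eval (φ.toFun z) * φ.sqrtDeriv z := rfl

theorem norm_ofHardy (f : HardySpace) : ‖ofHardy φ f‖ = ‖f‖ := by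
  change ‖(ofHardy φ).symm (ofHardy φ f)‖ = ‖f‖
  rw [LinearEquiv.symm_apply_apply]

end SmirnovClass

/-! ### Closed analytic curves and the Cauchy integral -/

/-- `k` parametrizes, on the unit circle, a simple closed analytic curve: it is analytic and
conformal in a neighbourhood of the unit circle and injective on the circle. Either direction of
travel is allowed; reversing it (`k(u)` replaced by `k(1/u)`) only changes the sign of contour
integrals along the curve. -/
structure IsAnalyticParametrization (k : ℂ → ℂ) : Prop where
  exists_conformal_nhd : ∃ U : Set ℂ, IsOpen U ∧ sphere 0 1 ⊆ U ∧
    DifferentiableOn ℂ k U ∧ ∀ ζ ∈ U, deriv k ζ ≠ 0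
  injOn : InjOn k (sphere 0 1)

/-- The normalized arc length measure `|dz| / 2π` of the curve `t ↦ k (exp (i t))`,
`0 < t ≤ 2π`, whose speed is `|k' (exp (i t))|`. -/
def arcLength (k : ℂ → ℂ) : Measure ℂ :=
  ENNReal.ofReal (2 * Real.pi)⁻¹ •
    ((volume.restrict (Ioc 0 (2 * Real.pi))).withDensity
      fun t => ENNReal.ofReal ‖deriv k (circleMap 0 1 t)‖).map fun t => k (circleMap 0 1 t)

/-- The integrand of the contour integral of `f(ζ) / (ζ - z)` along the curve `ζ = k(u)`,
`|u| = 1`, written in the variable `u`. -/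
def cauchyIntegrand (k f : ℂ → ℂ) (z u : ℂ) : ℂ := f (k u) / (k u - z) * deriv k u

/-- The Cauchy integral `(1 / 2πi) ∫ f(ζ) / (ζ - z) dζ` along the curve `ζ = k(u)`, `|u| = 1`. -/
def cauchyIntegral (k f : ℂ → ℂ) (z : ℂ) : ℂ :=
  (2 * Real.pi * Complex.I)⁻¹ * ∮ u in C(0, 1), cauchyIntegrand k f z u

end

/-!
The Cauchy kernel of `D`, transplanted to the unit disc, is the Szegő kernel of the disc up to a
smoothing kernel.

Let `ψ` be the inverse of the Riemann map `φ`. The compositions `φ ∘ k` and `k⁻¹ ∘ ψ` are defined on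
one side of the unit circle, near it, and their moduli tend to `1` at the circle, because `φ` is
proper and `∂D = k(∂Δ)`. By Schwarz reflection (`exists_extension_across_circle`) both extend
analytically across the circle, where they are inverse to each other; so `ψ` extends to a univalent
function `Ψ` on a disc of radius `R > 1`, and `k = Ψ ∘ θ` on the circle for an analytic
diffeomorphism `θ` of the circle (`exists_boundaryExtension`). Let `S` be the branch of `Ψ' ^ (1/2)`
on that disc for which `S · (φ' ^ (1/2) ∘ ψ) = 1`.

A function `g` on `D` belongs to `E²(D)` exactly when `S · (g ∘ ψ)` belongs to `H²`, with the same
norm. For `g` the Cauchy integral of `f`, this function is the integral of `f(k(u)) k'(u)`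
against the kernel `S(w) / (Ψ(ω) - Ψ(w))` with `ω = θ(u)`. As a function of `w` on the larger disc
this kernel has only a simple pole at `ω`, with singular part `S(ω)⁻¹ / (ω - w)`
(`kernel_eq_szego_add`). Its `n`th Taylor coefficient is therefore `S(ω)⁻¹ ω ^ (-n-1)` plus a term
that is `O(ρ ^ (-n))` for a fixed `ρ > 1` (`hasSum_kernel`, `norm_smoothCoeff_le`). Integrated
against an `L²` function, the second terms are trivially square summable. The first ones are handled
by Bessel's inequality: the powers of `θ(e ^ (it))` are orthogonal with respect to the measure
`|d arg θ|`, which is comparable to `dt` (`exists_bessel_bound`).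
-/

section

open Filter Complex
open scoped Topology Real ComplexConjugate

/-! ### Cauchy integrals on circles -/

/-- A Cauchy integral over a circle is analytic outside the circle. -/
theorem differentiableAt_circleIntegral_sub_inv_smul {f : ℂ → ℂ} {r : ℝ} (hr : 0 ≤ r)
    (hf : ContinuousOn f (sphere 0 r)) {v : ℂ} (hv : r < ‖v‖) :
    DifferentiableAt ℂ (fun v => ∮ ζ in C(0, r), (ζ - v)⁻¹ • f ζ) v := by
  have hfc : Continuous fun t => f (circleMap 0 r t) :=
    hf.comp_continuous (continuous_circleMap 0 r) fun t => circleMap_mem_sphere 0 hr t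
  set δ := (‖v‖ - r) / 2 with hδ
  have hδ0 : 0 < δ := by linarith
  have hfar : ∀ x ∈ ball v δ, ∀ t, δ ≤ ‖circleMap 0 r t - x‖ := by
    intro x hx t
    have h1 : ‖circleMap 0 r t‖ = r := by simp [abs_of_nonneg hr]
    have h2 : ‖x - v‖ < δ := by simpa [dist_eq_norm] using hx
    have h3 := norm_sub_norm_le x (circleMap 0 r t)
    have h4 := norm_sub_norm_le v x
    rw [norm_sub_rev] at h3 h4
    linarith
  have hne : ∀ x ∈ ball v δ, ∀ t, circleMap 0 r t - x ≠ 0 := fun x hx t h => by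
    have := hfar x hx t
    rw [h, norm_zero] at this
    linarith
  have hc : ∀ x ∈ ball v δ, Continuous fun t => circleMap 0 r t * I * ((circleMap 0 r t - x)⁻¹ *
      f (circleMap 0 r t)) := fun x hx =>
    ((continuous_circleMap 0 r).mul continuous_const).mul
      ((((continuous_circleMap 0 r).sub continuous_const).inv₀ (hne x hx)).mul hfc)
  have hc' : Continuous fun t => circleMap 0 r t * I * (((circleMap 0 r t - v) ^ 2)⁻¹ *
      f (circleMap 0 r t)) :=
    ((continuous_circleMap 0 r).mul continuous_const).mul
      (((((continuous_circleMap 0 r).sub continuous_const).pow 2).inv₀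
        (fun t => pow_ne_zero 2 (hne v (mem_ball_self hδ0) t))).mul hfc)
  have key := intervalIntegral.hasDerivAt_integral_of_dominated_loc_of_deriv_le (𝕜 := ℂ)
    (μ := volume) (a := 0) (b := 2 * π)
    (F := fun x t => circleMap 0 r t * I * ((circleMap 0 r t - x)⁻¹ * f (circleMap 0 r t)))
    (F' := fun x t => circleMap 0 r t * I * (((circleMap 0 r t - x) ^ 2)⁻¹ *
      f (circleMap 0 r t))) (x₀ := v) (s := ball v δ)
    (bound := fun t => r * ((δ ^ 2)⁻¹ * ‖f (circleMap 0 r t)‖)) (ball_mem_nhds v hδ0)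
    ?_ ((hc v (mem_ball_self hδ0)).intervalIntegrable _ _) hc'.aestronglyMeasurable
    ?_ ?_ ?_
  · refine key.2.differentiableAt.congr_of_eventuallyEq (Eventually.of_forall fun x => ?_)
    simp [circleIntegral, mul_comm, mul_left_comm]
  · filter_upwards [ball_mem_nhds v hδ0] with x hx using (hc x hx).aestronglyMeasurable
  · refine Eventually.of_forall fun t _ x hx => ?_
    have h1 := hfar x hx t
    simp only [norm_mul, norm_inv, norm_pow, norm_I, mul_one, norm_circleMap_zero, abs_of_nonneg hr]
    gcongr
  · exact ((continuous_const.mul (continuous_const.mul hfc.norm))).intervalIntegrable _ _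
  · refine Eventually.of_forall fun t _ x hx => ?_
    have h1 : HasDerivAt (fun x : ℂ => circleMap 0 r t - x) (-1) x := by
      simpa using (hasDerivAt_id x).const_sub (circleMap 0 r t)
    have h2 := ((h1.fun_inv (hne x hx t)).mul_const (f (circleMap 0 r t))).const_mul
      (circleMap 0 r t * I)
    simpa [neg_neg, div_eq_mul_inv] using h2

/-- Cauchy's integral formula for an annulus. -/
theorem circleIntegral_annulus_sub_inv_smul {f : ℂ → ℂ} {U : Set ℂ} (hU : IsOpen U)
    (hf : DifferentiableOn ℂ f U) {r R : ℝ} (hr : 0 < r) (hrR : r ≤ R)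
    (hsub : closedBall 0 R \ ball 0 r ⊆ U) {v : ℂ} (hrv : r < ‖v‖) (hvR : ‖v‖ < R) :
    (∮ ζ in C(0, R), (ζ - v)⁻¹ • f ζ) - (∮ ζ in C(0, r), (ζ - v)⁻¹ • f ζ) =
      2 * π * I * f v := by
  have hvU : v ∈ U := hsub ⟨by simpa using hvR.le, by simpa using hrv.le⟩
  have hF : DifferentiableOn ℂ (dslope f v) U :=
    (Complex.differentiableOn_dslope (hU.mem_nhds hvU)).2 hf
  have hsR : sphere (0 : ℂ) R ⊆ U := fun ζ hζ => hsub (by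
    rw [mem_sphere_zero_iff_norm] at hζ; simp [hζ, hrR])
  have hsr : sphere (0 : ℂ) r ⊆ U := fun ζ hζ => hsub (by
    rw [mem_sphere_zero_iff_norm] at hζ; simp [hζ, hrR])
  have hE := circleIntegral_eq_of_differentiable_on_annulus_off_countable hr hrR countable_empty
    (hF.continuousOn.mono hsub) (f := dslope f v) fun z hz =>
      hF.differentiableAt (hU.mem_nhds (hsub ⟨ball_subset_closedBall hz.1.1,
        fun h => hz.1.2 (ball_subset_closedBall h)⟩))
  have aux : ∀ ρ, 0 ≤ ρ → sphere (0 : ℂ) ρ ⊆ U → ‖v‖ ≠ ρ →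
      (∮ ζ in C(0, ρ), dslope f v ζ) =
        (∮ ζ in C(0, ρ), (ζ - v)⁻¹ • f ζ) - (∮ ζ in C(0, ρ), (ζ - v)⁻¹) * f v := by
    intro ρ hρ hs hvρ
    have hne : ∀ ζ ∈ sphere (0 : ℂ) ρ, ζ - v ≠ 0 := by
      intro ζ hζ h
      rw [mem_sphere_zero_iff_norm] at hζ
      rw [sub_eq_zero] at h
      exact hvρ (h ▸ hζ)
    have hi : ContinuousOn (fun ζ : ℂ => (ζ - v)⁻¹) (sphere 0 ρ) :=
      (continuousOn_id.sub continuousOn_const).inv₀ hne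
    have h2 : (∮ ζ in C(0, ρ), (ζ - v)⁻¹) * f v = ∮ ζ in C(0, ρ), (ζ - v)⁻¹ * f v := by
      rw [mul_comm, ← circleIntegral.integral_const_mul]
      simp only [mul_comm]
    have i1 : CircleIntegrable (fun ζ => (ζ - v)⁻¹ • f ζ) 0 ρ :=
      (hi.smul (hf.continuousOn.mono hs)).circleIntegrable hρ
    have i2 : CircleIntegrable (fun ζ => (ζ - v)⁻¹ * f v) 0 ρ :=
      (hi.mul continuousOn_const).circleIntegrable hρ
    rw [h2, ← circleIntegral.integral_sub i1 i2]
    refine circleIntegral.integral_congr hρ fun ζ hζ => ?_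
    have : ζ ≠ v := sub_ne_zero.1 (hne ζ hζ)
    simp only [dslope_of_ne f this, slope, vsub_eq_sub, smul_eq_mul]
    ring
  rw [aux R (hr.le.trans hrR) hsR hvR.ne, aux r hr.le hsr hrv.ne'] at hE
  have h1 : (∮ ζ in C(0, R), (ζ - v)⁻¹) = 2 * π * I :=
    circleIntegral.integral_sub_inv_of_mem_ball (by simpa using hvR)
  have h0 : (∮ ζ in C(0, r), (ζ - v)⁻¹) = 0 := by
    have hne : ∀ ζ ∈ closedBall (0 : ℂ) r, ζ - v ≠ 0 := by
      intro ζ hζ h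
      rw [mem_closedBall_zero_iff] at hζ
      rw [sub_eq_zero] at h
      exact absurd (h ▸ hζ) (not_le.2 hrv)
    refine circleIntegral_eq_zero_of_differentiable_on_off_countable hr.le countable_empty
      ((continuousOn_id.sub continuousOn_const).inv₀ hne) fun z hz => ?_
    exact (differentiableAt_id.sub_const v).inv (hne z (ball_subset_closedBall hz.1))
  rw [h1, h0] at hE
  linear_combination hE

/-! ### Schwarz reflection across the unit circle -/

theorem isOpen_annulus (r R : ℝ) : IsOpen {v : ℂ | r < ‖v‖ ∧ ‖v‖ < R} :=
  (isOpen_lt continuous_const continuous_norm).inter (isOpen_lt continuous_norm continuous_const)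

/-- Schwarz reflection for a function whose values lie in the annulus `1 / 2 < |w| < 1`.

The reflected function `g v = 1 / conj (h (1 / conj v))` is analytic outside the circle, and
`g (ρ⁻¹ e ^ (it)) - h (ρ e ^ (it))` tends to `0` uniformly as `ρ → 1`, although `h` itself is not
known to have boundary values. Hence the Cauchy integral of `g` over an outer circle minus that of
`h` over an inner circle equals `h` inside, and it is analytic in between. -/
theorem exists_extension_across_circle_aux {r : ℝ} (hr0 : 1 / 2 ≤ r) (hr1 : r < 1) {h : ℂ → ℂ}
    (hd : DifferentiableOn ℂ h {v | r < ‖v‖ ∧ ‖v‖ < 1})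
    (hlt : ∀ v, r < ‖v‖ → ‖v‖ < 1 → ‖h v‖ < 1)
    (hge : ∀ v, r < ‖v‖ → ‖v‖ < 1 → 1 / 2 < ‖h v‖)
    (hlim : ∀ a < 1, ∃ r' < 1, ∀ v : ℂ, r' < ‖v‖ → ‖v‖ < 1 → a < ‖h v‖) :
    ∃ r' H, r < r' ∧ r' < 1 ∧ DifferentiableOn ℂ H {v | r' < ‖v‖ ∧ ‖v‖ < r'⁻¹} ∧
      ∀ v, r' < ‖v‖ → ‖v‖ < 1 → H v = h v := by
  have hr : 0 < r := by linarith
  set A : Set ℂ := {v | r < ‖v‖ ∧ ‖v‖ < 1} with hA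
  have hAo : IsOpen A := isOpen_annulus r 1
  set B : Set ℂ := {v | 1 < ‖v‖ ∧ ‖v‖ < r⁻¹} with hB
  have hBo : IsOpen B := isOpen_annulus 1 r⁻¹
  have hBA : ∀ v ∈ B, conj v⁻¹ ∈ A := by
    intro v hv
    have h0 : 0 < ‖v‖ := by linarith [hv.1]
    simp only [hA, mem_ofPred_eq, RCLike.norm_conj, norm_inv]
    exact ⟨(lt_inv_comm₀ hr h0).2 hv.2, inv_lt_one_of_one_lt₀ hv.1⟩
  have hA0 : ∀ v ∈ A, h v ≠ 0 := fun v hv h0 => by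
    have := hge v hv.1 hv.2
    rw [h0, norm_zero] at this
    linarith
  set g : ℂ → ℂ := fun v => (conj (h (conj v⁻¹)))⁻¹ with hg
  have hgd : DifferentiableOn ℂ g B := by
    intro v hv
    have h0 : v ≠ 0 := by
      rintro rfl
      have := hv.1
      rw [norm_zero] at this
      linarith
    have h1 : DifferentiableAt ℂ h (conj v⁻¹) := hd.differentiableAt (hAo.mem_nhds (hBA v hv))
    have h2 : DifferentiableAt ℂ (conj ∘ h ∘ conj) (v⁻¹) := by
      simpa using h1.conj_conj
    have h3 : DifferentiableAt ℂ ((conj ∘ h ∘ conj) ∘ fun v => v⁻¹) v :=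
      DifferentiableAt.comp v h2 (differentiableAt_inv h0)
    refine (h3.inv ?_).differentiableWithinAt
    simpa using hA0 _ (hBA v hv)
  obtain ⟨s, hrs, hs1⟩ := exists_between hr1
  have hs0 : 0 < s := by linarith
  have hsi : 1 < s⁻¹ := (one_lt_inv₀ hs0).2 hs1
  have hsri : s⁻¹ < r⁻¹ := (inv_lt_inv₀ hs0 hr).2 hrs
  have hcs : ContinuousOn h (sphere 0 s) := hd.continuousOn.mono fun ζ hζ => by
    rw [mem_sphere_zero_iff_norm] at hζ
    exact ⟨by rw [hζ]; exact hrs, by rw [hζ]; exact hs1⟩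
  have hcsi : ContinuousOn g (sphere 0 s⁻¹) := hgd.continuousOn.mono fun ζ hζ => by
    rw [mem_sphere_zero_iff_norm] at hζ
    exact ⟨by rw [hζ]; exact hsi, by rw [hζ]; exact hsri⟩
  refine ⟨s, fun v => (2 * π * I : ℂ)⁻¹ * ((∮ ζ in C(0, s⁻¹), (ζ - v)⁻¹ • g ζ) -
    ∮ ζ in C(0, s), (ζ - v)⁻¹ • h ζ), hrs, hs1, ?_, ?_⟩
  · intro v hv
    refine DifferentiableAt.differentiableWithinAt ?_
    have h1 : DifferentiableAt ℂ (fun w => (2 * π * I : ℂ)⁻¹ • ∮ z in C(0, s⁻¹), (z - w)⁻¹ • g z)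
        v := by
      lift s to NNReal using hs0.le
      have := hasFPowerSeriesOn_cauchy_integral (R := s⁻¹) (f := g) (c := 0)
        (by simpa using hcsi.circleIntegrable (inv_nonneg.2 hs0.le)) (by simpa using hs0)
      simpa using this.differentiableOn.differentiableAt
        (Metric.isOpen_eball.mem_nhds (by simpa [enorm_eq_nnnorm, ← NNReal.coe_lt_coe] using hv.2))
    have h2 := differentiableAt_circleIntegral_sub_inv_smul hs0.le hcs hv.1
    simp only [mul_sub]
    simp only [smul_eq_mul] at h1 h2 ⊢
    exact h1.sub (h2.const_mul _)
  · intro v hv1 hv2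
    -- By Cauchy's theorem, the defect of the formula at `v` is for every `ρ` close to `1` the
    -- difference of the Cauchy integrals of `g` over `|ζ| = ρ⁻¹` and of `h` over `|ζ| = ρ`.
    have hjump : ∀ ρ, s < ρ → ‖v‖ < ρ → ρ < 1 →
        (∮ ζ in C(0, s⁻¹), (ζ - v)⁻¹ • g ζ) - (∮ ζ in C(0, s), (ζ - v)⁻¹ • h ζ) -
          2 * π * I * h v =
        (∮ ζ in C(0, ρ⁻¹), (ζ - v)⁻¹ • g ζ) - (∮ ζ in C(0, ρ), (ζ - v)⁻¹ • h ζ) := by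
      intro ρ hsρ hvρ hρ1
      have hρ0 : 0 < ρ := by linarith
      have e1 := circleIntegral_annulus_sub_inv_smul hAo hd hs0 hsρ.le (v := v) (fun ζ hζ => by
        simp only [Set.mem_sdiff, mem_closedBall_zero_iff, mem_ball_zero_iff, not_lt] at hζ
        exact ⟨by linarith, by linarith⟩) hv1 hvρ
      have hρi : 1 < ρ⁻¹ := (one_lt_inv₀ hρ0).2 hρ1
      have hsub : closedBall (0 : ℂ) s⁻¹ \ ball 0 ρ⁻¹ ⊆ B := fun ζ hζ => by
        simp only [Set.mem_sdiff, mem_closedBall_zero_iff, mem_ball_zero_iff, not_lt] at hζ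
        exact ⟨by linarith, by linarith⟩
      have hd2 : DifferentiableOn ℂ (fun ζ => (ζ - v)⁻¹ • g ζ) B := by
        refine DifferentiableOn.smul (DifferentiableOn.inv (differentiableOn_id.sub_const v) fun ζ hζ h0 => ?_) hgd
        have := hζ.1
        rw [show ζ = v from sub_eq_zero.1 h0] at this
        linarith
      have e2 := circleIntegral_eq_of_differentiable_on_annulus_off_countable
        (inv_pos.2 hρ0) ((inv_le_inv₀ hρ0 hs0).2 hsρ.le) countable_empty
        (hd2.continuousOn.mono hsub) fun z hz =>
          hd2.differentiableAt (hBo.mem_nhds (hsub ⟨ball_subset_closedBall hz.1.1,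
            fun h => hz.1.2 (ball_subset_closedBall h)⟩))
      rw [e2]
      linear_combination e1
    set d := 1 - ‖v‖ with hd'
    have hd0 : 0 < d := by linarith
    set K : ℝ := 4 / d + 8 / d ^ 2 with hK
    have hK0 : 0 < K := by positivity
    -- This difference is small if `|h|` is close to `1` on `|ζ| = ρ`.
    have hbound : ∀ ε > 0, ‖(∮ ζ in C(0, s⁻¹), (ζ - v)⁻¹ • g ζ) -
        (∮ ζ in C(0, s), (ζ - v)⁻¹ • h ζ) - 2 * π * I * h v‖ ≤ K * ε * |2 * π - 0| := by
      intro ε hε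
      obtain ⟨r', hr', hr'h⟩ := hlim (1 - ε) (by linarith)
      obtain ⟨ρ, hρ, hρ1⟩ := exists_between
        (show max (max s ((1 + ‖v‖) / 2)) (max r' (1 - ε)) < 1 by
          simp only [max_lt_iff]; refine ⟨⟨hs1, ?_⟩, hr', ?_⟩ <;> linarith)
      simp only [max_lt_iff] at hρ
      obtain ⟨⟨hsρ, hvρ⟩, hrρ, hερ⟩ := hρ
      have hρ0 : 0 < ρ := by linarith
      have hρi : 1 < ρ⁻¹ := (one_lt_inv₀ hρ0).2 hρ1
      have hρA : ∀ t, circleMap 0 ρ t ∈ A := fun t => by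
        simp only [hA, mem_ofPred_eq, norm_circleMap_zero, abs_of_pos hρ0]
        exact ⟨by linarith, hρ1⟩
      have hρB : ∀ t, circleMap 0 ρ⁻¹ t ∈ B := fun t => by
        simp only [hB, mem_ofPred_eq, norm_circleMap_zero, abs_of_pos (inv_pos.2 hρ0)]
        exact ⟨hρi, (inv_lt_inv₀ hρ0 hr).2 (by linarith)⟩
      have hconj : ∀ t, conj (circleMap 0 ρ⁻¹ t)⁻¹ = circleMap 0 ρ t := fun t => by
        simp [circleMap, ← Complex.exp_conj, ← Complex.exp_neg, mul_comm]
      have hden : ∀ t, d / 2 ≤ ‖circleMap 0 ρ t - v‖ := fun t => by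
        have := norm_sub_norm_le (circleMap 0 ρ t) v
        rw [norm_circleMap_zero, abs_of_pos hρ0] at this
        linarith
      have hden' : ∀ t, d * ρ⁻¹ ≤ ‖circleMap 0 ρ⁻¹ t - v‖ := fun t => by
        have := norm_sub_norm_le (circleMap 0 ρ⁻¹ t) v
        rw [norm_circleMap_zero, abs_of_pos (inv_pos.2 hρ0)] at this
        nlinarith [norm_nonneg v]
      have hne : ∀ t, circleMap 0 ρ t - v ≠ 0 := fun t => norm_pos_iff.1 (by linarith [hden t])
      have hne' : ∀ t, circleMap 0 ρ⁻¹ t - v ≠ 0 := fun t =>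
        norm_pos_iff.1 (lt_of_lt_of_le (by positivity) (hden' t))
      have hcA : Continuous fun t => h (circleMap 0 ρ t) :=
        hd.continuousOn.comp_continuous (continuous_circleMap _ _) hρA
      have hcB : Continuous fun t => g (circleMap 0 ρ⁻¹ t) :=
        hgd.continuousOn.comp_continuous (continuous_circleMap _ _) hρB
      rw [hjump ρ hsρ (by linarith) hρ1, circleIntegral, circleIntegral,
        ← intervalIntegral.integral_sub]
      rotate_left
      · refine Continuous.intervalIntegrable ?_ _ _
        simp only [deriv_circleMap]
        exact ((continuous_circleMap _ _).mul continuous_const).smul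
          ((((continuous_circleMap _ _).sub continuous_const).inv₀ hne').smul hcB)
      · refine Continuous.intervalIntegrable ?_ _ _
        simp only [deriv_circleMap]
        exact ((continuous_circleMap _ _).mul continuous_const).smul
          ((((continuous_circleMap _ _).sub continuous_const).inv₀ hne).smul hcA)
      refine intervalIntegral.norm_integral_le_of_norm_le_const fun t _ => ?_
      simp only [deriv_circleMap, smul_eq_mul]
      have hgt : g (circleMap 0 ρ⁻¹ t) = (conj (h (circleMap 0 ρ t)))⁻¹ := by
        simp only [hg, hconj]
      set x := circleMap 0 ρ t with hx
      set y := circleMap 0 ρ⁻¹ t with hy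
      have hnx : ‖x‖ = ρ := by simp [hx, abs_of_pos hρ0]
      have hny : ‖y‖ = ρ⁻¹ := by simp [hy, abs_of_pos hρ0]
      have hxy : ‖x - y‖ = ρ⁻¹ - ρ := by
        have : x - y = (((ρ - ρ⁻¹ : ℝ) : ℂ)) * Complex.exp (t * I) := by
          simp [hx, hy, circleMap, sub_mul]
        rw [this, norm_mul, Complex.norm_exp_ofReal_mul_I, mul_one, Complex.norm_real,
          Real.norm_eq_abs, abs_of_neg (by linarith)]
        ring
      have hxA := hρA t
      have hh1 := hlt x hxA.1 hxA.2
      have hh2 := hge x hxA.1 hxA.2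
      have hh3 := hr'h x (by rw [hnx]; exact hrρ) hxA.2
      have hh0 : h x ≠ 0 := hA0 x hxA
      have hsplit : y * I * ((y - v)⁻¹ * g y) - x * I * ((x - v)⁻¹ * h x) =
          I * (y * (y - v)⁻¹ * (g y - h x) + v * (x - y) * ((y - v)⁻¹ * (x - v)⁻¹) * h x) := by
        have a := hne t
        have b := hne' t
        rw [← hx] at a
        rw [← hy] at b
        field_simp
        ring
      have hgh : ‖g y - h x‖ ≤ 4 * ε := by
        have e : g y - h x = (conj (h x))⁻¹ * ((1 - ‖h x‖ ^ 2 : ℝ) : ℂ) := by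
          rw [hgt]
          have : conj (h x) ≠ 0 := by simpa using hh0
          field_simp
          push_cast
          rw [← Complex.conj_mul']
        rw [e, norm_mul, norm_inv, RCLike.norm_conj, Complex.norm_real, Real.norm_eq_abs,
          abs_of_nonneg (by nlinarith), inv_mul_le_iff₀ (by linarith)]
        nlinarith
      have b1 : ‖y * (y - v)⁻¹‖ ≤ 1 / d := by
        have := hden' t
        rw [← hy] at this
        rw [norm_mul, norm_inv, hny, mul_inv_le_iff₀ (lt_of_lt_of_le (by positivity) this)]
        rw [one_div, inv_mul_eq_div, le_div_iff₀ hd0]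
        linarith
      have b2 : ‖(y - v)⁻¹‖ ≤ 1 / d := by
        have := hden' t
        rw [← hy] at this
        rw [norm_inv, one_div]
        refine inv_anti₀ hd0 (le_trans ?_ this)
        nlinarith
      have b3 : ‖(x - v)⁻¹‖ ≤ 2 / d := by
        have := hden t
        rw [← hx] at this
        rw [norm_inv, show (2 / d) = (d / 2)⁻¹ by rw [inv_div]]
        exact inv_anti₀ (by positivity) this
      have b4 : ρ⁻¹ - ρ ≤ 4 * ε := by
        rw [sub_le_iff_le_add, inv_le_iff_one_le_mul₀ hρ0]
        nlinarith
      rw [hsplit, norm_mul, norm_I, one_mul]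
      calc _ ≤ ‖y * (y - v)⁻¹‖ * ‖g y - h x‖ +
            ‖v‖ * ‖x - y‖ * (‖(y - v)⁻¹‖ * ‖(x - v)⁻¹‖) * ‖h x‖ := by
              refine (norm_add_le _ _).trans_eq ?_
              simp only [norm_mul]
        _ ≤ 1 / d * (4 * ε) + 1 * (4 * ε) * (1 / d * (2 / d)) * 1 := by
              rw [hxy]
              have : 0 ≤ ρ⁻¹ - ρ := by linarith
              gcongr
        _ = K * ε := by
              rw [hK]
              field_simp
              ring
    have hzero : (∮ ζ in C(0, s⁻¹), (ζ - v)⁻¹ • g ζ) -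
        (∮ ζ in C(0, s), (ζ - v)⁻¹ • h ζ) - 2 * π * I * h v = 0 := by
      rw [← norm_le_zero_iff]
      refine le_of_forall_pos_le_add fun ε hε => ?_
      have h2 : (0 : ℝ) < K * |2 * π - 0| :=
        mul_pos hK0 (abs_pos.2 (by simp [Real.pi_ne_zero]))
      have := hbound (ε / (K * |2 * π - 0|)) (by positivity)
      refine this.trans_eq ?_
      field_simp
      ring
    rw [sub_eq_zero] at hzero
    beta_reduce
    rw [hzero, inv_mul_cancel_left₀]
    simp [Real.pi_ne_zero]

/-- Schwarz reflection: a function that is analytic just inside the unit circle and whose modulus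
tends to `1` at the circle extends analytically across it. The limit is uniform in the argument,
but no continuity of `h` up to the circle is assumed. -/
theorem exists_extension_across_circle {r : ℝ} (hr1 : r < 1) {h : ℂ → ℂ}
    (hd : DifferentiableOn ℂ h {v | r < ‖v‖ ∧ ‖v‖ < 1})
    (hlt : ∀ v, r < ‖v‖ → ‖v‖ < 1 → ‖h v‖ < 1)
    (hlim : ∀ a < 1, ∃ r' < 1, ∀ v : ℂ, r' < ‖v‖ → ‖v‖ < 1 → a < ‖h v‖) :
    ∃ r' H, 0 < r' ∧ r < r' ∧ r' < 1 ∧ DifferentiableOn ℂ H {v | r' < ‖v‖ ∧ ‖v‖ < r'⁻¹} ∧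
      (∀ v, r' < ‖v‖ → ‖v‖ < 1 → H v = h v) ∧ ∀ v, ‖v‖ = 1 → ‖H v‖ = 1 := by
  obtain ⟨r₁, hr₁, hh⟩ := hlim (1 / 2) (by norm_num)
  set ρ := max (max r r₁) (1 / 2) with hρ
  have hρ1 : ρ < 1 := by simp only [hρ, max_lt_iff]; exact ⟨⟨hr1, hr₁⟩, by norm_num⟩
  have hrρ : r ≤ ρ := (le_max_left _ _).trans (le_max_left _ _)
  have hr₁ρ : r₁ ≤ ρ := (le_max_right _ _).trans (le_max_left _ _)
  have hρ2 : 1 / 2 ≤ ρ := le_max_right _ _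
  obtain ⟨r', H, h1, h2, h3, h4⟩ := exists_extension_across_circle_aux (h := h) hρ2 hρ1
    (hd.mono fun v hv => ⟨hrρ.trans_lt hv.1, hv.2⟩)
    (fun v hv hv' => hlt v (hrρ.trans_lt hv) hv') (fun v hv hv' => hh v (hr₁ρ.trans_lt hv) hv') hlim
  have hr'0 : 0 < r' := by linarith
  refine ⟨r', H, hr'0, by linarith, h2, h3, h4, fun v hv => ?_⟩
  have hvm : v ∈ {v : ℂ | r' < ‖v‖ ∧ ‖v‖ < r'⁻¹} :=
    ⟨by rw [hv]; exact h2, by rw [hv]; exact (one_lt_inv₀ hr'0).2 h2⟩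
  have hc : ContinuousAt H v :=
    (h3.differentiableAt ((isOpen_annulus _ _).mem_nhds hvm)).continuousAt
  have ht : Tendsto (fun t : ℝ => ‖H (t * v)‖) (𝓝[<] 1) (𝓝 ‖H v‖) := by
    have : Tendsto (fun t : ℝ => (t : ℂ) * v) (𝓝[<] 1) (𝓝 v) := by
      have : Continuous fun t : ℝ => (t : ℂ) * v := by fun_prop
      simpa using (this.tendsto 1).mono_left nhdsWithin_le_nhds
    exact (hc.tendsto.comp this).norm
  have hn : ∀ t : ℝ, 0 < t → ‖(t : ℂ) * v‖ = t := fun t ht => by simp [hv, abs_of_pos ht]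
  refine le_antisymm (le_of_tendsto ht ?_) (le_of_forall_lt fun a ha => ?_)
  · filter_upwards [Ioo_mem_nhdsLT h2] with t ht
    have hnt := hn t (hr'0.trans ht.1)
    rw [h4 _ (by rw [hnt]; exact ht.1) (by rw [hnt]; exact ht.2)]
    exact (hlt _ (by rw [hnt]; linarith [ht.1]) (by rw [hnt]; exact ht.2)).le
  · obtain ⟨b, hab, hb⟩ := exists_between ha
    obtain ⟨r₂, hr₂, hr₂h⟩ := hlim b hb
    refine hab.trans_le (ge_of_tendsto ht ?_)
    filter_upwards [Ioo_mem_nhdsLT (max_lt h2 hr₂)] with t ht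
    obtain ⟨ht1, ht2⟩ := max_lt_iff.1 ht.1
    have hnt := hn t (hr'0.trans ht1)
    rw [h4 _ (by rw [hnt]; exact ht1) (by rw [hnt]; exact ht.2)]
    exact (hr₂h _ (by rw [hnt]; exact ht2) (by rw [hnt]; exact ht.2)).le

/-! ### Univalent maps near compact sets and near the circle -/

theorem hasStrictDerivAt_of_differentiableOn {f : ℂ → ℂ} {U : Set ℂ} (hU : IsOpen U)
    (hf : DifferentiableOn ℂ f U) {z : ℂ} (hz : z ∈ U) : HasStrictDerivAt f (deriv f z) z :=
  (hf.analyticAt (hU.mem_nhds hz)).hasStrictDerivAt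

/-- The inverse of a univalent function is analytic on its open image. -/
theorem isOpen_image_and_differentiableOn_invFunOn {f : ℂ → ℂ} {U : Set ℂ} (hU : IsOpen U)
    (hf : DifferentiableOn ℂ f U) (hinj : InjOn f U) (hd : ∀ z ∈ U, deriv f z ≠ 0) :
    IsOpen (f '' U) ∧ DifferentiableOn ℂ (Function.invFunOn f U) (f '' U) := by
  have hmap : ∀ z ∈ U, map f (𝓝 z) = 𝓝 (f z) := fun z hz =>
    (hasStrictDerivAt_of_differentiableOn hU hf hz).map_nhds_eq (hd z hz)
  have hleft : ∀ z ∈ U, Function.invFunOn f U (f z) = z := fun z hz => hinj.leftInvOn_invFunOn hz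
  have hopen : IsOpen (f '' U) := by
    rw [isOpen_iff_mem_nhds]
    rintro _ ⟨z, hz, rfl⟩
    rw [← hmap z hz]
    exact image_mem_map (hU.mem_nhds hz)
  refine ⟨hopen, ?_⟩
  rintro _ ⟨z, hz, rfl⟩
  have hc : ContinuousAt (Function.invFunOn f U) (f z) := by
    rw [ContinuousAt, ← hmap z hz, tendsto_map'_iff, hleft z hz]
    refine tendsto_id.congr' ?_
    filter_upwards [hU.mem_nhds hz] with x hx using (hleft x hx).symm
  refine (HasStrictDerivAt.of_local_left_inverse (f := f) (f' := deriv f z) hc ?_ (hd z hz)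
    ?_).hasDerivAt.differentiableAt.differentiableWithinAt
  · rw [hleft z hz]
    exact hasStrictDerivAt_of_differentiableOn hU hf hz
  · filter_upwards [hopen.mem_nhds (mem_image_of_mem f hz)] with y hy
    exact Function.invFunOn_eq hy

/-- A conformal map that is injective on a compact set is univalent near it. -/
theorem exists_isOpen_superset_injOn {f : ℂ → ℂ} {U K : Set ℂ} (hU : IsOpen U) (hKU : K ⊆ U)
    (hK : IsCompact K) (hf : DifferentiableOn ℂ f U) (hinj : InjOn f K)
    (hd : ∀ z ∈ K, deriv f z ≠ 0) :
    ∃ V, IsOpen V ∧ K ⊆ V ∧ V ⊆ U ∧ InjOn f V ∧ ∀ z ∈ V, deriv f z ≠ 0 := by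
  obtain ⟨t, ht, hKt, hinjt⟩ := hinj.exists_isOpen_superset hK
    (fun z hz => (hf.differentiableAt (hU.mem_nhds (hKU hz))).continuousAt) fun z hz => by
      have h := (hasStrictDerivAt_of_differentiableOn hU hf (hKU hz)).hasStrictFDerivAt_equiv (hd z hz)
      refine ⟨_, h.eventually_left_inverse, fun x hx y hy hxy => ?_⟩
      rw [← show h.localInverse f _ z (f x) = x from hx, hxy]
      exact hy
  have ho : IsOpen (U ∩ deriv f ⁻¹' {0}ᶜ) :=
    (hf.deriv hU).continuousOn.isOpen_inter_preimage hU isOpen_compl_singleton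
  exact ⟨t ∩ (U ∩ deriv f ⁻¹' {0}ᶜ), ht.inter ho, fun z hz => ⟨hKt hz, hKU hz, hd z hz⟩,
    fun z hz => hz.2.1, hinjt.mono inter_subset_left, fun z hz => hz.2.2⟩

theorem exists_annulus_subset {U : Set ℂ} (hU : IsOpen U) (h : sphere 0 1 ⊆ U) :
    ∃ r, 0 < r ∧ r < 1 ∧ {v : ℂ | r < ‖v‖ ∧ ‖v‖ < r⁻¹} ⊆ U := by
  obtain ⟨δ, hδ, hs⟩ := (isCompact_sphere (0 : ℂ) 1).exists_thickening_subset_open hU h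
  refine ⟨(1 + δ)⁻¹, by positivity, inv_lt_one_of_one_lt₀ (by linarith), fun v hv => hs ?_⟩
  obtain ⟨h1, h2⟩ := hv
  rw [inv_inv] at h2
  have hv0 : 0 < ‖v‖ := lt_trans (by positivity) h1
  rw [mem_thickening_iff]
  refine ⟨((‖v‖⁻¹ : ℝ) : ℂ) * v, ?_, ?_⟩
  · simp [hv0.ne']
  · have : v - ((‖v‖⁻¹ : ℝ) : ℂ) * v = (((1 - ‖v‖⁻¹ : ℝ)) : ℂ) * v := by push_cast; ring
    rw [dist_eq_norm, this, norm_mul, Complex.norm_real, Real.norm_eq_abs, ← abs_of_pos hv0,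
      ← abs_mul, abs_of_pos hv0, sub_mul, inv_mul_cancel₀ hv0.ne', abs_lt]
    have h3 : 1 < ‖v‖ * (1 + δ) := by rwa [inv_lt_iff_one_lt_mul₀ (by positivity)] at h1
    constructor <;> nlinarith

theorem exists_ball_subset {U : Set ℂ} (hU : IsOpen U) (h : closedBall 0 1 ⊆ U) :
    ∃ ρ, 1 < ρ ∧ ball (0 : ℂ) ρ ⊆ U := by
  obtain ⟨δ, hδ, hs⟩ := (isCompact_closedBall (0 : ℂ) 1).exists_thickening_subset_open hU h
  rw [thickening_closedBall hδ zero_le_one] at hs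
  exact ⟨δ + 1, by linarith, hs⟩

/-- By the identity theorem, an inversion relation that holds inside the unit circle near a boundary
point holds in a full neighbourhood of that point. -/
theorem comp_eventuallyEq_id_of_inside {f g : ℂ → ℂ} {u : ℂ} (hu : ‖u‖ = 1)
    (hf : AnalyticAt ℂ f u) (hg : AnalyticAt ℂ g (f u))
    (h : ∀ᶠ v in 𝓝 u, ‖v‖ < 1 → g (f v) = v) : ∀ᶠ v in 𝓝 u, g (f v) = v := by
  refine ((hg.comp hf).frequently_eq_iff_eventually_eq analyticAt_id).1 ?_
  have hne : (𝓝[ball (0 : ℂ) 1] u).NeBot := by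
    rw [← mem_closure_iff_nhdsWithin_neBot, closure_ball _ one_ne_zero]
    simp [hu]
  have hle : 𝓝[ball (0 : ℂ) 1] u ≤ 𝓝[≠] u := nhdsWithin_mono _ fun v hv hvu => by
    rw [mem_singleton_iff] at hvu
    rw [hvu, mem_ball_zero_iff, hu] at hv
    exact lt_irrefl _ hv
  refine Frequently.filter_mono (Eventually.frequently ?_) hle
  filter_upwards [nhdsWithin_le_nhds h, self_mem_nhdsWithin] with v hv hv1
  exact hv (by simpa using hv1)

theorem deriv_ne_zero_of_comp_eventuallyEq_id {f g : ℂ → ℂ} {u : ℂ}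
    (hf : DifferentiableAt ℂ f u) (hg : DifferentiableAt ℂ g (f u))
    (h : ∀ᶠ v in 𝓝 u, g (f v) = v) : deriv f u ≠ 0 := by
  intro h0
  have h1 := (hg.hasDerivAt.comp u hf.hasDerivAt).congr_of_eventuallyEq
    (f₁ := id) (by filter_upwards [h] with v hv using hv.symm)
  rw [h0, mul_zero] at h1
  exact zero_ne_one (h1.unique (hasDerivAt_id u))

/-! ### Analytic continuation of the inverse Riemann map -/

/-- A univalent extension past the unit circle of the inverse of the Riemann map `φ`, together with
the change of parameter `param` on the unit circle for which `k = invMap ∘ param`. The map `param`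
may reverse the orientation of the circle. -/
structure BoundaryExtension {D : Set ℂ} (φ : RiemannMap D) (k : ℂ → ℂ) where
  /-- the radius of a disc to which the inverse of `φ` extends -/
  radius : ℝ
  one_lt_radius : 1 < radius
  /-- the extended inverse of `φ` -/
  invMap : ℂ → ℂ
  differentiableOn_invMap : DifferentiableOn ℂ invMap (ball 0 radius)
  injOn_invMap : InjOn invMap (ball 0 radius)
  deriv_invMap_ne_zero : ∀ w ∈ ball 0 radius, deriv invMap w ≠ 0
  invMap_mem : ∀ w ∈ ball 0 1, invMap w ∈ D
  apply_invMap : ∀ w ∈ ball 0 1, φ.toFun (invMap w) = w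
  /-- the parameter on the unit circle of the point `k u` -/
  param : ℂ → ℂ
  /-- a neighbourhood of the unit circle on which `param` is analytic -/
  nhd : Set ℂ
  isOpen_nhd : IsOpen nhd
  sphere_subset_nhd : sphere 0 1 ⊆ nhd
  differentiableOn_param : DifferentiableOn ℂ param nhd
  norm_param : ∀ u ∈ sphere 0 1, ‖param u‖ = 1
  deriv_param_ne_zero : ∀ u ∈ sphere 0 1, deriv param u ≠ 0
  invMap_param : ∀ u ∈ sphere 0 1, invMap (param u) = k u

variable {D : Set ℂ}

/-- The extension exists when `k` maps the inner side of the unit circle into `D` and the outer side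
out of `D`. Reflection applies to `φ ∘ k` and to `k⁻¹ ∘ ψ`; the extension of `ψ` is `k` composed with
the reflection of `k⁻¹ ∘ ψ`. -/
theorem exists_boundaryExtension_of_inside (hD : IsOpen D) (hDb : Bornology.IsBounded D)
    (φ : RiemannMap D) {k : ℂ → ℂ} {r : ℝ} (hr0 : 0 < r) (hr1 : r < 1)
    (hk : DifferentiableOn ℂ k {v | r < ‖v‖ ∧ ‖v‖ < r⁻¹})
    (hkinj : InjOn k {v | r < ‖v‖ ∧ ‖v‖ < r⁻¹})
    (hkd : ∀ v ∈ {v : ℂ | r < ‖v‖ ∧ ‖v‖ < r⁻¹}, deriv k v ≠ 0)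
    (hkD : frontier D = k '' sphere 0 1)
    (hin : ∀ v, r < ‖v‖ → ‖v‖ < 1 → k v ∈ D)
    (hout : ∀ v, 1 < ‖v‖ → ‖v‖ < r⁻¹ → k v ∉ D) : Nonempty (BoundaryExtension φ k) := by
  set N : Set ℂ := {v | r < ‖v‖ ∧ ‖v‖ < r⁻¹} with hN
  have hNo : IsOpen N := isOpen_annulus _ _
  have hri : 1 < r⁻¹ := (one_lt_inv₀ hr0).2 hr1
  have hsN : sphere (0 : ℂ) 1 ⊆ N := fun u hu => by
    rw [mem_sphere_zero_iff_norm] at hu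
    exact ⟨by rwa [hu], by rwa [hu]⟩
  have hsD : ∀ u : ℂ, ‖u‖ = 1 → k u ∉ D := fun u hu hkuD => by
    have h1 : k u ∈ frontier D := hkD ▸ mem_image_of_mem k (by simpa using hu)
    rw [hD.frontier_eq] at h1
    exact h1.2 hkuD
  have hφinj := φ.bijOn.injOn
  obtain ⟨-, hψd⟩ := isOpen_image_and_differentiableOn_invFunOn hD φ.differentiableOn hφinj
    φ.deriv_ne_zero
  rw [φ.bijOn.image_eq] at hψd
  set ψ := Function.invFunOn φ.toFun D with hψ
  have hψD : ∀ w ∈ ball (0 : ℂ) 1, ψ w ∈ D := fun w hw =>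
    Function.invFunOn_mem (φ.bijOn.surjOn hw)
  have hφψ : ∀ w ∈ ball (0 : ℂ) 1, φ.toFun (ψ w) = w := fun w hw =>
    Function.invFunOn_eq (φ.bijOn.surjOn hw)
  have hψφ : ∀ z ∈ D, ψ (φ.toFun z) = z := fun z hz => hφinj.leftInvOn_invFunOn hz
  obtain ⟨hkNo, hκd⟩ := isOpen_image_and_differentiableOn_invFunOn hNo hk hkinj hkd
  set κ := Function.invFunOn k N with hκ
  have hκk : ∀ v ∈ N, κ (k v) = v := fun v hv => hkinj.leftInvOn_invFunOn hv
  -- `|φ(k v)| → 1`, as `k v` leaves every compact subset of `D`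
  have hlim1 : ∀ a < 1, ∃ r' < 1, ∀ v : ℂ, r' < ‖v‖ → ‖v‖ < 1 → a < ‖φ.toFun (k v)‖ := by
    intro a ha
    have hsub : closedBall (0 : ℂ) a ⊆ ball 0 1 := closedBall_subset_ball ha
    have hC : IsClosed (ψ '' closedBall 0 a) :=
      ((isCompact_closedBall (0 : ℂ) a).image_of_continuousOn
        (hψd.continuousOn.mono hsub)).isClosed
    have ho : IsOpen (N ∩ k ⁻¹' (ψ '' closedBall 0 a)ᶜ) :=
      hk.continuousOn.isOpen_inter_preimage hNo hC.isOpen_compl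
    obtain ⟨s, hs0, hs1, hs⟩ := exists_annulus_subset ho fun u hu => ⟨hsN hu, by
      rintro ⟨w, hw, hwu⟩
      exact hsD u (by simpa using hu) (hwu ▸ hψD w (hsub hw))⟩
    refine ⟨s, hs1, fun v hv hv1 => ?_⟩
    obtain ⟨hvN, hvC⟩ := hs ⟨hv, hv1.trans ((one_lt_inv₀ hs0).2 hs1)⟩
    by_contra! hle
    exact hvC ⟨φ.toFun (k v), by simpa using hle, hψφ _ (hin v hvN.1 hv1)⟩
  -- `|k⁻¹(ψ w)| → 1`, as `ψ w` leaves the compact set `closure D \ k(b < |v| < b⁻¹)` for every `b`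
  have hlim2 : ∀ a < 1, ∃ r' < 1, ∀ w : ℂ, r' < ‖w‖ → ‖w‖ < 1 →
      ∃ v, a < ‖v‖ ∧ r < ‖v‖ ∧ ‖v‖ < 1 ∧ k v = ψ w := by
    intro a ha
    set b := max a r with hb
    have hb0 : 0 < b := lt_max_of_lt_right hr0
    have hb1 : b < 1 := max_lt ha hr1
    have hbi : 1 < b⁻¹ := (one_lt_inv₀ hb0).2 hb1
    have hNb : {v : ℂ | b < ‖v‖ ∧ ‖v‖ < b⁻¹} ⊆ N := fun v hv =>
      ⟨(le_max_right _ _).trans_lt hv.1, hv.2.trans_le (inv_anti₀ hr0 (le_max_right _ _))⟩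
    have hbo := (isOpen_image_and_differentiableOn_invFunOn (isOpen_annulus b b⁻¹)
      (hk.mono hNb) (hkinj.mono hNb) fun v hv => hkd v (hNb hv)).1
    set C := closure D \ k '' {v : ℂ | b < ‖v‖ ∧ ‖v‖ < b⁻¹} with hC
    have hCc : IsCompact C := hDb.isCompact_closure.diff hbo
    have hCD : C ⊆ D := by
      rintro z ⟨hz, hzk⟩
      by_contra hzD
      have h1 : z ∈ frontier D := by rw [hD.frontier_eq]; exact ⟨hz, hzD⟩
      rw [hkD] at h1
      obtain ⟨u, hu, rfl⟩ := h1
      rw [mem_sphere_zero_iff_norm] at hu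
      exact hzk ⟨u, ⟨by rwa [hu], by rwa [hu]⟩, rfl⟩
    obtain ⟨s, hs, hsC⟩ := exists_pos_lt_subset_ball one_pos
      (hCc.image_of_continuousOn (φ.differentiableOn.continuousOn.mono hCD)).isClosed
      (show φ.toFun '' C ⊆ ball 0 1 from
        (image_mono hCD).trans φ.bijOn.mapsTo.image_subset)
    refine ⟨s, hs.2, fun w hw hw1 => ?_⟩
    have hwb : w ∈ ball (0 : ℂ) 1 := by simpa using hw1
    have hwC : ψ w ∉ C := fun h => by
      have := hsC (mem_image_of_mem φ.toFun h)
      rw [hφψ w hwb, mem_ball_zero_iff] at this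
      exact lt_asymm this hw
    have hwk : ψ w ∈ k '' {v : ℂ | b < ‖v‖ ∧ ‖v‖ < b⁻¹} := by
      by_contra h
      exact hwC ⟨subset_closure (hψD w hwb), h⟩
    obtain ⟨v, hv, hvw⟩ := hwk
    have hvN := hNb hv
    refine ⟨v, (le_max_left _ _).trans_lt hv.1, hvN.1, ?_, hvw⟩
    rcases lt_trichotomy ‖v‖ 1 with h | h | h
    · exact h
    · exact absurd (hvw ▸ hψD w hwb) (hsD v h)
    · exact absurd (hvw ▸ hψD w hwb) (hout v h hvN.2)
  have hball : ∀ {w : ℂ}, ‖w‖ < 1 → w ∈ ball (0 : ℂ) 1 := fun h => by simpa using h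
  obtain ⟨r₁, Φ, hr₁0, hr₁r, hr₁1, hΦd, hΦ, hΦ1⟩ := exists_extension_across_circle
    (h := fun v => φ.toFun (k v)) hr1 (fun v hv =>
      ((φ.differentiableOn.differentiableAt (hD.mem_nhds (hin v hv.1 hv.2))).comp v
        (hk.differentiableAt (hNo.mem_nhds ⟨hv.1, hv.2.trans hri⟩))).differentiableWithinAt)
    (fun v hv hv' => by simpa using φ.bijOn.mapsTo (hin v hv hv')) hlim1
  obtain ⟨r₀, hr₀, hr₀k⟩ := hlim2 r hr1
  have hκψ : ∀ w, r₀ < ‖w‖ → ‖w‖ < 1 → k (κ (ψ w)) = ψ w ∧ r < ‖κ (ψ w)‖ ∧ ‖κ (ψ w)‖ < 1 ∧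
      ψ w ∈ k '' N := by
    intro w hw hw'
    obtain ⟨v, -, hv, hv1, hvw⟩ := hr₀k w hw hw'
    have hvN : v ∈ N := ⟨hv, hv1.trans hri⟩
    rw [← hvw, hκk v hvN]
    exact ⟨rfl, hv, hv1, mem_image_of_mem k hvN⟩
  obtain ⟨r₂, V, hr₂0, hr₂r, hr₂1, hVd, hV, hV1⟩ := exists_extension_across_circle
    (h := fun w => κ (ψ w)) hr₀ (fun w hw =>
      ((hκd.differentiableAt (hkNo.mem_nhds (hκψ w hw.1 hw.2).2.2.2)).comp w
        (hψd.differentiableAt (isOpen_ball.mem_nhds (hball hw.2)))).differentiableWithinAt)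
    (fun w hw hw' => (hκψ w hw hw').2.2.1) (fun a ha => by
      obtain ⟨s, hs, hsk⟩ := hlim2 a ha
      refine ⟨s, hs, fun w hw hw' => ?_⟩
      obtain ⟨v, hv, hvr, hv1, hvw⟩ := hsk w hw hw'
      rwa [← hvw, hκk v ⟨hvr, hv1.trans hri⟩])
  have hr₁m : ∀ u : ℂ, ‖u‖ = 1 → u ∈ {v : ℂ | r₁ < ‖v‖ ∧ ‖v‖ < r₁⁻¹} := fun u hu =>
    ⟨by rwa [hu], by rw [hu]; exact (one_lt_inv₀ hr₁0).2 hr₁1⟩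
  have hr₂m : ∀ u : ℂ, ‖u‖ = 1 → u ∈ {v : ℂ | r₂ < ‖v‖ ∧ ‖v‖ < r₂⁻¹} := fun u hu =>
    ⟨by rwa [hu], by rw [hu]; exact (one_lt_inv₀ hr₂0).2 hr₂1⟩
  have hΦa : ∀ u : ℂ, ‖u‖ = 1 → AnalyticAt ℂ Φ u := fun u hu =>
    hΦd.analyticAt ((isOpen_annulus _ _).mem_nhds (hr₁m u hu))
  have hVa : ∀ u : ℂ, ‖u‖ = 1 → AnalyticAt ℂ V u := fun u hu =>
    hVd.analyticAt ((isOpen_annulus _ _).mem_nhds (hr₂m u hu))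
  -- the two extensions are inverse to each other near the circle
  have hVΦ : ∀ u : ℂ, ‖u‖ = 1 → ∀ᶠ v in 𝓝 u, V (Φ v) = v := by
    intro u hu
    refine comp_eventuallyEq_id_of_inside hu (hΦa u hu) (hVa _ (hΦ1 u hu)) ?_
    filter_upwards [(isOpen_annulus _ _).mem_nhds (hr₁m u hu), (hΦa u hu).continuousAt.preimage_mem_nhds
      ((isOpen_annulus _ _).mem_nhds (hr₂m _ (hΦ1 u hu)))] with v hv1 hv2 hv
    have hvD := hin v (hr₁r.trans hv1.1) hv
    have e := hΦ v hv1.1 hv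
    have hv2' := hv2.1
    rw [e] at hv2' ⊢
    rw [hV _ hv2' (by simpa using φ.bijOn.mapsTo hvD), hψφ _ hvD,
      hκk v ⟨hr₁r.trans hv1.1, hv.trans hri⟩]
  have hΦV : ∀ u : ℂ, ‖u‖ = 1 → ∀ᶠ v in 𝓝 u, Φ (V v) = v := by
    intro u hu
    refine comp_eventuallyEq_id_of_inside hu (hVa u hu) (hΦa _ (hV1 u hu)) ?_
    filter_upwards [(isOpen_annulus _ _).mem_nhds (hr₂m u hu), (hVa u hu).continuousAt.preimage_mem_nhds
      ((isOpen_annulus _ _).mem_nhds (hr₁m _ (hV1 u hu)))] with v hv1 hv2 hv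
    obtain ⟨h1, h2, h3, h4⟩ := hκψ v (hr₂r.trans hv1.1) hv
    have e := hV v hv1.1 hv
    have hv2' := hv2.1
    rw [e] at hv2' ⊢
    rw [hΦ _ hv2' h3, h1, hφψ v (hball hv)]
  -- The two formulas for the extension agree on the inner side of the circle.
  have hN2 : IsOpen ({v : ℂ | r₂ < ‖v‖ ∧ ‖v‖ < r₂⁻¹} ∩ V ⁻¹' N) :=
    hVd.continuousOn.isOpen_inter_preimage (isOpen_annulus _ _) hNo
  obtain ⟨s, hs0, hs1, hs⟩ := exists_annulus_subset hN2 fun u hu => by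
    rw [mem_sphere_zero_iff_norm] at hu
    exact ⟨hr₂m u hu, hsN (by simpa using hV1 u hu)⟩
  have hsi : 1 < s⁻¹ := (one_lt_inv₀ hs0).2 hs1
  set Ψ : ℂ → ℂ := fun w => if ‖w‖ < 1 then ψ w else k (V w) with hΨ
  have hΨ1 : ∀ w, ‖w‖ < 1 → Ψ w = ψ w := fun w hw => if_pos hw
  have hΨ2 : ∀ w ∈ {v : ℂ | s < ‖v‖ ∧ ‖v‖ < s⁻¹}, Ψ w = k (V w) := by
    intro w hw
    by_cases h1 : ‖w‖ < 1
    · have hw2 := (hs hw).1.1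
      rw [hΨ1 w h1, hV w hw2 h1, (hκψ w (hr₂r.trans hw2) h1).1]
    · exact if_neg h1
  have hΨe1 : ∀ w : ℂ, ‖w‖ < 1 → Ψ =ᶠ[𝓝 w] ψ := fun w hw => by
    filter_upwards [isOpen_ball.mem_nhds (hball hw)] with x hx using hΨ1 x (by simpa using hx)
  have hΨe2 : ∀ w ∈ {v : ℂ | s < ‖v‖ ∧ ‖v‖ < s⁻¹}, Ψ =ᶠ[𝓝 w] k ∘ V := fun w hw => by
    filter_upwards [(isOpen_annulus _ _).mem_nhds hw] with x hx using hΨ2 x hx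
  have hkV : ∀ w ∈ {v : ℂ | s < ‖v‖ ∧ ‖v‖ < s⁻¹},
      HasDerivAt (k ∘ V) (deriv k (V w) * deriv V w) w := fun w hw =>
    (hk.differentiableAt (hNo.mem_nhds (hs hw).2)).hasDerivAt.comp w
      (hVd.differentiableAt ((isOpen_annulus _ _).mem_nhds (hs hw).1)).hasDerivAt
  have hΨd : DifferentiableOn ℂ Ψ (ball 0 s⁻¹) := by
    intro w hw
    refine DifferentiableAt.differentiableWithinAt ?_
    rw [mem_ball_zero_iff] at hw
    by_cases h1 : ‖w‖ < 1
    · exact (hψd.differentiableAt (isOpen_ball.mem_nhds (hball h1))).congr_of_eventuallyEq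
        (hΨe1 w h1)
    · have hwm : w ∈ {v : ℂ | s < ‖v‖ ∧ ‖v‖ < s⁻¹} := ⟨by linarith, hw⟩
      exact (hkV w hwm).differentiableAt.congr_of_eventuallyEq (hΨe2 w hwm)
  have hsm : ∀ u : ℂ, ‖u‖ = 1 → u ∈ {v : ℂ | s < ‖v‖ ∧ ‖v‖ < s⁻¹} := fun u hu =>
    ⟨by rwa [hu], by rwa [hu]⟩
  have hΨ' : ∀ w ∈ closedBall (0 : ℂ) 1, deriv Ψ w ≠ 0 := by
    intro w hw
    rw [mem_closedBall_zero_iff] at hw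
    rcases hw.lt_or_eq with h1 | h1
    · rw [(hΨe1 w h1).deriv_eq]
      refine deriv_ne_zero_of_comp_eventuallyEq_id
        (hψd.differentiableAt (isOpen_ball.mem_nhds (hball h1)))
        (φ.differentiableOn.differentiableAt (hD.mem_nhds (hψD w (hball h1)))) ?_
      filter_upwards [isOpen_ball.mem_nhds (hball h1)] with x hx using hφψ x hx
    · rw [(hΨe2 w (hsm w h1)).deriv_eq, (hkV w (hsm w h1)).deriv]
      exact mul_ne_zero (hkd _ (hs (hsm w h1)).2) (deriv_ne_zero_of_comp_eventuallyEq_id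
        (hVa w h1).differentiableAt (hΦa _ (hV1 w h1)).differentiableAt (hΦV w h1))
  have hΨD : ∀ w : ℂ, ‖w‖ = 1 → Ψ w ∉ D := fun w hw => by
    rw [hΨ2 w (hsm w hw)]
    exact hsD _ (hV1 w hw)
  have hΨinj : InjOn Ψ (closedBall 0 1) := by
    intro w hw x hx hwx
    rw [mem_closedBall_zero_iff] at hw hx
    rcases hw.lt_or_eq with h1 | h1 <;> rcases hx.lt_or_eq with h2 | h2
    · rw [hΨ1 w h1, hΨ1 x h2] at hwx
      rw [← hφψ w (hball h1), hwx, hφψ x (hball h2)]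
    · refine absurd ?_ (hΨD x h2)
      rw [← hwx, hΨ1 w h1]
      exact hψD w (hball h1)
    · refine absurd ?_ (hΨD w h1)
      rw [hwx, hΨ1 x h2]
      exact hψD x (hball h2)
    · rw [hΨ2 w (hsm w h1), hΨ2 x (hsm x h2)] at hwx
      have := hkinj (hs (hsm w h1)).2 (hs (hsm x h2)).2 hwx
      rw [← (hΦV w h1).self_of_nhds, this, (hΦV x h2).self_of_nhds]
  obtain ⟨W, hWo, hW1, hWs, hWinj, hWd⟩ := exists_isOpen_superset_injOn isOpen_ball
    (closedBall_subset_ball hsi) (isCompact_closedBall 0 1) hΨd hΨinj hΨ'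
  obtain ⟨ρ, hρ, hρW⟩ := exists_ball_subset hWo hW1
  exact ⟨{
    radius := ρ
    one_lt_radius := hρ
    invMap := Ψ
    differentiableOn_invMap := hΨd.mono (hρW.trans hWs)
    injOn_invMap := hWinj.mono hρW
    deriv_invMap_ne_zero := fun w hw => hWd w (hρW hw)
    invMap_mem := fun w hw => by rw [hΨ1 w (by simpa using hw)]; exact hψD w hw
    apply_invMap := fun w hw => by rw [hΨ1 w (by simpa using hw)]; exact hφψ w hw
    param := Φ
    nhd := {v : ℂ | r₁ < ‖v‖ ∧ ‖v‖ < r₁⁻¹}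
    isOpen_nhd := isOpen_annulus _ _
    sphere_subset_nhd := fun u hu => hr₁m u (by simpa using hu)
    differentiableOn_param := hΦd
    norm_param := fun u hu => hΦ1 u (by simpa using hu)
    deriv_param_ne_zero := fun u hu => by
      rw [mem_sphere_zero_iff_norm] at hu
      exact deriv_ne_zero_of_comp_eventuallyEq_id (hΦa u hu).differentiableAt
        (hVa _ (hΦ1 u hu)).differentiableAt (hVΦ u hu)
    invMap_param := fun u hu => by
      rw [mem_sphere_zero_iff_norm] at hu
      rw [hΨ2 _ (hsm _ (hΦ1 u hu)), (hVΦ u hu).self_of_nhds] }⟩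

/-! ### The side of the curve on which the domain lies -/

theorem isPreconnected_annulus {r : ℝ} (hr : 0 ≤ r) (R : ℝ) :
    IsPreconnected {v : ℂ | r < ‖v‖ ∧ ‖v‖ < R} := by
  have : {v : ℂ | r < ‖v‖ ∧ ‖v‖ < R} =
      (fun p : ℝ × ℝ => (p.1 : ℂ) * Complex.exp (p.2 * I)) '' (Ioo r R ×ˢ univ) := by
    ext v
    constructor
    · intro hv
      exact ⟨(‖v‖, arg v), ⟨hv, trivial⟩, norm_mul_exp_arg_mul_I v⟩
    · rintro ⟨⟨a, t⟩, ⟨ha, -⟩, rfl⟩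
      have : ‖(a : ℂ) * Complex.exp (t * I)‖ = a := by
        rw [norm_mul, norm_exp_ofReal_mul_I, mul_one, Complex.norm_real, Real.norm_eq_abs,
          abs_of_pos (hr.trans_lt ha.1)]
      rw [mem_ofPred_eq, this]
      exact ha
  rw [this]
  exact (isPreconnected_Ioo.prod isPreconnected_univ).image _ (by fun_prop)

theorem IsPreconnected.subset_or_disjoint_of_disjoint_frontier {s : Set ℂ} (hs : IsPreconnected s)
    (hD : IsOpen D) (h : Disjoint s (frontier D)) : s ⊆ D ∨ Disjoint s D := by
  rcases (s ∩ D).eq_empty_or_nonempty with h0 | h0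
  · exact Or.inr (disjoint_iff_inter_eq_empty.2 h0)
  · refine Or.inl (hs.subset_left_of_subset_union hD isClosed_closure.isOpen_compl
      (disjoint_left.2 fun z hz hz' => hz' (subset_closure hz)) (fun z hz => ?_) h0)
    by_contra! hz'
    rw [mem_union, not_or, mem_compl_iff, not_not] at hz'
    refine disjoint_left.1 h hz ?_
    rw [hD.frontier_eq]
    exact ⟨hz'.2, hz'.1⟩

/-- The extension for `k` obtained from one for the reversed parametrization `v ↦ k v⁻¹`. -/
noncomputable def BoundaryExtension.reverse {φ : RiemannMap D} {k : ℂ → ℂ}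
    (e : BoundaryExtension φ fun v => k v⁻¹) : BoundaryExtension φ k :=
  have hs : ∀ u ∈ sphere (0 : ℂ) 1, u⁻¹ ∈ sphere (0 : ℂ) 1 := fun u hu => by
    simpa using hu
  have h0 : ∀ u ∈ sphere (0 : ℂ) 1, u ≠ 0 := fun u hu => ne_zero_of_mem_unit_sphere ⟨u, hu⟩
  { e with
    param := fun v => e.param v⁻¹
    nhd := {0}ᶜ ∩ (fun v => v⁻¹) ⁻¹' e.nhd
    isOpen_nhd := ContinuousOn.isOpen_inter_preimage (continuousOn_inv₀)
      isOpen_compl_singleton e.isOpen_nhd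
    sphere_subset_nhd := fun u hu => ⟨h0 u hu, e.sphere_subset_nhd (hs u hu)⟩
    differentiableOn_param := e.differentiableOn_param.comp
      (differentiableOn_inv.mono inter_subset_left) fun v hv => hv.2
    norm_param := fun u hu => e.norm_param _ (hs u hu)
    deriv_param_ne_zero := fun u hu => by
      have h1 := ((e.differentiableOn_param.differentiableAt
        (e.isOpen_nhd.mem_nhds (e.sphere_subset_nhd (hs u hu)))).hasDerivAt.comp u
          (hasDerivAt_inv (h0 u hu))).deriv
      change deriv (e.param ∘ fun v => v⁻¹) u ≠ 0
      rw [h1]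
      exact mul_ne_zero (e.deriv_param_ne_zero _ (hs u hu))
        (neg_ne_zero.2 (inv_ne_zero (pow_ne_zero 2 (h0 u hu))))
    invMap_param := fun u hu => by
      have := e.invMap_param _ (hs u hu)
      simpa using this }

/-- The inverse of the Riemann map extends univalently past the unit circle. Exactly one side of the
circle is mapped by `k` into `D`; if it is the outer side, the direction of travel is reversed. -/
theorem exists_boundaryExtension (hD : IsOpen D) (hDb : Bornology.IsBounded D) (φ : RiemannMap D)
    {k : ℂ → ℂ} (hk : IsAnalyticParametrization k) (hkD : frontier D = k '' sphere 0 1) :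
    Nonempty (BoundaryExtension φ k) := by
  obtain ⟨⟨U, hU, hsU, hkU, hkd⟩, hkinj⟩ := hk
  obtain ⟨W, hWo, hsW, hWU, hWinj, hWd⟩ := exists_isOpen_superset_injOn hU hsU
    (isCompact_sphere 0 1) hkU hkinj fun z hz => hkd z (hsU hz)
  obtain ⟨r, hr0, hr1, hrW⟩ := exists_annulus_subset hWo hsW
  set N : Set ℂ := {v | r < ‖v‖ ∧ ‖v‖ < r⁻¹} with hN
  have hri : 1 < r⁻¹ := (one_lt_inv₀ hr0).2 hr1
  have hNo : IsOpen N := isOpen_annulus _ _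
  have hkN : DifferentiableOn ℂ k N := (hkU.mono hWU).mono hrW
  have hinjN : InjOn k N := hWinj.mono hrW
  have hdN : ∀ v ∈ N, deriv k v ≠ 0 := fun v hv => hWd v (hrW hv)
  have hsN : sphere (0 : ℂ) 1 ⊆ N := fun u hu => by
    rw [mem_sphere_zero_iff_norm] at hu
    exact ⟨by rwa [hu], by rwa [hu]⟩
  have hside : ∀ A ⊆ N, IsPreconnected A → (∀ v ∈ A, ‖v‖ ≠ 1) →
      (k '' A ⊆ D ∨ Disjoint (k '' A) D) := by
    intro A hAN hA hA1
    refine (hA.image k (hkN.continuousOn.mono hAN)).subset_or_disjoint_of_disjoint_frontier hD ?_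
    rw [hkD, disjoint_left]
    rintro _ ⟨v, hv, rfl⟩ ⟨u, hu, huv⟩
    have := hinjN (hsN hu) (hAN hv) huv
    exact hA1 v hv (by rw [← this]; simpa using hu)
  have hinN : {v : ℂ | r < ‖v‖ ∧ ‖v‖ < 1} ⊆ N := fun v hv => ⟨hv.1, hv.2.trans hri⟩
  have houtN : {v : ℂ | 1 < ‖v‖ ∧ ‖v‖ < r⁻¹} ⊆ N := fun v hv => ⟨hr1.trans hv.1, hv.2⟩
  have hin := hside _ hinN (isPreconnected_annulus hr0.le 1) fun v hv => hv.2.ne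
  have hout := hside _ houtN (isPreconnected_annulus zero_le_one _) fun v hv => hv.1.ne'
  have hkNo := (isOpen_image_and_differentiableOn_invFunOn hNo hkN hinjN hdN).1
  have hk1 : k 1 ∈ closure D := by
    refine frontier_subset_closure ?_
    rw [hkD]
    exact mem_image_of_mem k (by simp)
  have hcl : closure D = D ∪ k '' sphere 0 1 := by
    rw [closure_eq_self_union_frontier, hkD]
  rcases hin with hin | hin <;> rcases hout with hout | hout
  · -- if both sides lay in `D`, then `closure D` would be open, closed and bounded
    exfalso
    have hNcl : k '' N ⊆ closure D := by
      rintro _ ⟨v, hv, rfl⟩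
      rcases lt_trichotomy ‖v‖ 1 with h | h | h
      · exact subset_closure (hin ⟨v, ⟨hv.1, h⟩, rfl⟩)
      · rw [hcl]
        exact Or.inr ⟨v, by simpa using h, rfl⟩
      · exact subset_closure (hout ⟨v, ⟨h, hv.2⟩, rfl⟩)
    have hclo : IsOpen (closure D) := by
      have : closure D = D ∪ k '' N := by
        refine Subset.antisymm ?_ (union_subset subset_closure hNcl)
        rw [hcl]
        exact union_subset_union_right _ (image_mono hsN)
      rw [this]
      exact hD.union hkNo
    have huniv := IsClopen.eq_univ ⟨isClosed_closure, hclo⟩ ⟨_, hk1⟩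
    exact NormedSpace.unbounded_univ ℝ ℂ (huniv ▸ hDb.closure)
  · exact exists_boundaryExtension_of_inside hD hDb φ hr0 hr1 hkN hinjN hdN hkD
      (fun v hv hv1 => hin ⟨v, ⟨hv, hv1⟩, rfl⟩)
      fun v hv hv1 => disjoint_left.1 hout ⟨v, ⟨hv, hv1⟩, rfl⟩
  · have hNinv : ∀ v ∈ N, v⁻¹ ∈ N := fun v hv => by
      have hv0 : 0 < ‖v‖ := hr0.trans hv.1
      rw [hN, mem_ofPred_eq, norm_inv]
      exact ⟨(lt_inv_comm₀ hr0 hv0).2 hv.2, (inv_lt_inv₀ hv0 hr0).2 hv.1⟩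
    have hN0 : ∀ v ∈ N, v ≠ 0 := fun v hv => norm_pos_iff.1 (hr0.trans hv.1)
    have hder : ∀ v ∈ N, HasDerivAt (k ∘ fun v => v⁻¹) (deriv k v⁻¹ * -(v ^ 2)⁻¹) v := fun v hv =>
      (hkN.differentiableAt (hNo.mem_nhds (hNinv v hv))).hasDerivAt.comp v
        (hasDerivAt_inv (hN0 v hv))
    obtain ⟨e⟩ := exists_boundaryExtension_of_inside hD hDb φ (k := k ∘ fun v => v⁻¹) hr0 hr1
      (fun v hv => (hder v hv).differentiableAt.differentiableWithinAt)
      (fun v hv x hx hvx => inv_injective (hinjN (hNinv v hv) (hNinv x hx) hvx))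
      (fun v hv => by
        rw [(hder v hv).deriv]
        exact mul_ne_zero (hdN _ (hNinv v hv))
          (neg_ne_zero.2 (inv_ne_zero (pow_ne_zero 2 (hN0 v hv)))))
      (by
        rw [hkD, image_comp]
        congr 1
        ext u
        constructor
        · exact fun hu => ⟨u⁻¹, by simpa using hu, inv_inv u⟩
        · rintro ⟨x, hx, rfl⟩
          simpa using hx)
      (fun v hv hv1 => hout ⟨v⁻¹, ⟨by
        rw [norm_inv]; exact (one_lt_inv₀ (hr0.trans hv)).2 hv1, (hNinv v ⟨hv, hv1.trans hri⟩).2⟩,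
        rfl⟩)
      fun v hv hv1 => disjoint_left.1 hin ⟨v⁻¹, ⟨(hNinv v ⟨hr1.trans hv, hv1⟩).1, by
        rw [norm_inv]; exact inv_lt_one_of_one_lt₀ hv⟩, rfl⟩
    exact ⟨e.reverse⟩
  · -- if neither side lay in `D`, then `k 1` would not be a boundary point
    exfalso
    obtain ⟨_, ⟨v, hv, rfl⟩, hvD⟩ := mem_closure_iff.1 hk1 _ hkNo
      (mem_image_of_mem k (hsN (by simp)))
    rcases lt_trichotomy ‖v‖ 1 with h | h | h
    · exact disjoint_left.1 hin ⟨v, ⟨hv.1, h⟩, rfl⟩ hvD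
    · have : k v ∈ frontier D := by rw [hkD]; exact ⟨v, by simpa using h, rfl⟩
      rw [hD.frontier_eq] at this
      exact this.2 hvD
    · exact disjoint_left.1 hout ⟨v, ⟨h, hv.2⟩, rfl⟩ hvD

/-! ### Expansion of the transplanted Cauchy kernel -/

theorem exists_sq_eq_of_ne_zero_on_ball {f : ℂ → ℂ} {R : ℝ} (hf : DifferentiableOn ℂ f (ball 0 R))
    (h0 : ∀ w ∈ ball 0 R, f w ≠ 0) :
    ∃ S : ℂ → ℂ, DifferentiableOn ℂ S (ball 0 R) ∧ ∀ w ∈ ball 0 R, S w ^ 2 = f w := by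
  rcases le_or_gt R 0 with hR | hR
  · exact ⟨0, by simp [ball_eq_empty.2 hR], by simp [ball_eq_empty.2 hR]⟩
  obtain ⟨g, hg⟩ := ((hf.deriv isOpen_ball).div hf h0).isExactOn_ball
  have hd : ∀ w ∈ ball (0 : ℂ) R, HasDerivAt (fun w => f w * Complex.exp (-g w)) 0 w := by
    intro w hw
    have h1 := (hf.differentiableAt (isOpen_ball.mem_nhds hw)).hasDerivAt.mul (hg w hw).neg.cexp
    refine h1.congr_deriv ?_
    have := h0 w hw
    simp only [Pi.div_apply]
    field_simp
    ring
  obtain ⟨c, hc⟩ := (isOpen_ball (x := (0 : ℂ)) (ε := R)).exists_is_const_of_deriv_eq_zero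
    (convex_ball (0 : ℂ) R).isPreconnected
    (fun w hw => (hd w hw).differentiableAt.differentiableWithinAt) fun w hw => (hd w hw).deriv
  obtain ⟨a, ha⟩ := IsAlgClosed.exists_pow_nat_eq c (n := 2) two_pos
  refine ⟨fun w => a * Complex.exp (g w / 2), fun w hw => ?_, fun w hw => ?_⟩
  · exact (((hg w hw).differentiableAt.div_const 2).cexp.const_mul a).differentiableWithinAt
  · beta_reduce
    rw [mul_pow, ha, ← hc w hw, ← Complex.exp_nat_mul, mul_assoc, ← Complex.exp_add]
    have : -g w + (2 : ℕ) * (g w / 2) = 0 := by push_cast; ring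
    rw [this, Complex.exp_zero, mul_one]

/-- The branch of `ψ' ^ (1/2)`, on the larger disc, that matches the given branch of
`φ' ^ (1/2)`. -/
theorem BoundaryExtension.exists_sqrt {D : Set ℂ} (hD : IsOpen D) {φ : RiemannMap D} {k : ℂ → ℂ}
    (e : BoundaryExtension φ k) :
    ∃ S : ℂ → ℂ, DifferentiableOn ℂ S (ball 0 e.radius) ∧
      (∀ w ∈ ball 0 e.radius, S w ^ 2 = deriv e.invMap w) ∧
      ∀ w ∈ ball 0 1, S w * φ.sqrtDeriv (e.invMap w) = 1 := by
  obtain ⟨S, hS, hS2⟩ := exists_sq_eq_of_ne_zero_on_ball (e.differentiableOn_invMap.deriv isOpen_ball)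
    e.deriv_invMap_ne_zero
  have hsub : ball (0 : ℂ) 1 ⊆ ball 0 e.radius := ball_subset_ball e.one_lt_radius.le
  have hsq : EqOn ((fun w => S w * φ.sqrtDeriv (e.invMap w)) ^ 2) 1 (ball 0 1) := by
    intro w hw
    have h1 : HasDerivAt (φ.toFun ∘ e.invMap) (deriv φ.toFun (e.invMap w) * deriv e.invMap w) w :=
      (φ.differentiableOn.differentiableAt (hD.mem_nhds (e.invMap_mem w hw))).hasDerivAt.comp w
        (e.differentiableOn_invMap.differentiableAt (isOpen_ball.mem_nhds (hsub hw))).hasDerivAt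
    have h2 := h1.congr_of_eventuallyEq (f₁ := id) (by
      filter_upwards [isOpen_ball.mem_nhds hw] with x hx using (e.apply_invMap x hx).symm)
    have h3 := h2.unique (hasDerivAt_id w)
    simp only [Pi.pow_apply, Pi.one_apply]
    rw [mul_pow, hS2 w (hsub hw), φ.sq_sqrtDeriv _ (e.invMap_mem w hw), mul_comm, h3]
  have hc : ContinuousOn (fun w => S w * φ.sqrtDeriv (e.invMap w)) (ball 0 1) :=
    (hS.continuousOn.mono hsub).mul (φ.differentiableOn_sqrtDeriv.continuousOn.comp
      (e.differentiableOn_invMap.continuousOn.mono hsub) e.invMap_mem)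
  rcases (convex_ball (0 : ℂ) 1).isPreconnected.eq_one_or_eq_neg_one_of_sq_eq hc hsq with h | h
  · exact ⟨S, hS, hS2, h⟩
  · refine ⟨-S, hS.neg, fun w hw => by simpa using hS2 w hw, fun w hw => ?_⟩
    have := h hw
    simp only [Pi.neg_apply, Pi.one_apply] at this ⊢
    rw [neg_mul, this, neg_neg]

/-- The transplanted Cauchy kernel is a multiple of the Szegő kernel `1 / (ω - w)` plus a kernel that
is analytic in `w` on the disc of radius `ρ`, given by the Cauchy integral of the kernel itself over
`|ζ| = ρ`. -/
theorem kernel_eq_szego_add {Ψ S : ℂ → ℂ} {R ρ : ℝ} (hΨ : DifferentiableOn ℂ Ψ (ball 0 R))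
    (hinj : InjOn Ψ (ball 0 R)) (hd : ∀ w ∈ ball 0 R, deriv Ψ w ≠ 0)
    (hS : DifferentiableOn ℂ S (ball 0 R)) (hS2 : ∀ w ∈ ball 0 R, S w ^ 2 = deriv Ψ w)
    (hρR : ρ < R) {ω w : ℂ} (hω : ‖ω‖ < ρ) (hw : ‖w‖ < ρ) (hne : ω ≠ w) :
    S w / (Ψ ω - Ψ w) = (S ω)⁻¹ * (ω - w)⁻¹ +
      (2 * π * I : ℂ)⁻¹ • ∮ ζ in C(0, ρ), (ζ - w)⁻¹ • (S ζ / (Ψ ω - Ψ ζ)) := by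
  have hωR : ω ∈ ball (0 : ℂ) R := by simpa using hω.trans hρR
  have hwR : w ∈ ball (0 : ℂ) R := by simpa using hw.trans hρR
  have hρ0 : 0 < ρ := (norm_nonneg w).trans_lt hw
  have hds : ∀ ζ ∈ ball (0 : ℂ) R, dslope Ψ ω ζ ≠ 0 := by
    intro ζ hζ
    by_cases h : ζ = ω
    · rw [h, dslope_same]
      exact hd ω hωR
    · rw [dslope_of_ne _ h, slope, vsub_eq_sub, smul_eq_mul]
      exact mul_ne_zero (inv_ne_zero (sub_ne_zero.2 h))
        (sub_ne_zero.2 fun h' => h (hinj hζ hωR h'))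
  set g : ℂ → ℂ := fun ζ => S ζ / dslope Ψ ω ζ with hg
  have hgd : DifferentiableOn ℂ g (ball 0 R) :=
    hS.div ((Complex.differentiableOn_dslope (isOpen_ball.mem_nhds hωR)).2 hΨ) hds
  have hker : ∀ ζ, ζ ≠ ω → S ζ / (Ψ ω - Ψ ζ) = -((ζ - ω)⁻¹ * g ζ) := by
    intro ζ hζ
    rw [hg]
    simp only
    rw [dslope_of_ne _ hζ, slope, vsub_eq_sub, smul_eq_mul]
    have := sub_ne_zero.2 hζ
    rw [← neg_sub (Ψ ζ), div_neg]
    field_simp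
  have hgω : g ω = (S ω)⁻¹ := by
    have hS0 : S ω ≠ 0 := fun h => hd ω hωR (by rw [← hS2 ω hωR, h]; simp)
    rw [hg]
    simp only
    rw [dslope_same, ← hS2 ω hωR]
    field_simp
  have hgρ : DifferentiableOn ℂ g (closedBall 0 ρ) := hgd.mono (closedBall_subset_ball hρR)
  have hcs : ContinuousOn g (sphere 0 ρ) := hgρ.continuousOn.mono sphere_subset_closedBall
  have cauchy : ∀ x : ℂ, ‖x‖ < ρ → (∮ ζ in C(0, ρ), (ζ - x)⁻¹ • g ζ) = (2 * π * I : ℂ) • g x :=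
    fun x hx => hgρ.circleIntegral_sub_inv_smul (by simpa using hx)
  have hsne : ∀ x : ℂ, ‖x‖ < ρ → ∀ ζ ∈ sphere (0 : ℂ) ρ, ζ - x ≠ 0 := by
    intro x hx ζ hζ h
    rw [mem_sphere_zero_iff_norm, sub_eq_zero.1 h] at hζ
    exact hx.ne hζ
  have hci : ∀ x : ℂ, ‖x‖ < ρ → CircleIntegrable (fun ζ => (ζ - x)⁻¹ • g ζ) 0 ρ := fun x hx =>
    (((continuousOn_id.sub continuousOn_const).inv₀ (hsne x hx)).smul hcs).circleIntegrable hρ0.le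
  have hI : (∮ ζ in C(0, ρ), (ζ - w)⁻¹ • (S ζ / (Ψ ω - Ψ ζ))) =
      -(ω - w)⁻¹ * ((2 * π * I : ℂ) * g ω - (2 * π * I : ℂ) * g w) := by
    rw [← smul_eq_mul (2 * π * I : ℂ), ← smul_eq_mul (2 * π * I : ℂ), ← cauchy ω hω, ← cauchy w hw,
      ← circleIntegral.integral_sub (hci ω hω) (hci w hw), ← circleIntegral.integral_const_mul]
    refine circleIntegral.integral_congr hρ0.le fun ζ hζ => ?_
    have a := hsne ω hω ζ hζ
    have b := hsne w hw ζ hζ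
    have c := sub_ne_zero.2 hne
    simp only [smul_eq_mul]
    rw [hker ζ (sub_ne_zero.1 a)]
    field_simp
    ring
  have hc := sub_ne_zero.2 hne
  have hc' := sub_ne_zero.2 hne.symm
  have hπ : (2 * π * I : ℂ) ≠ 0 := by simp [Real.pi_ne_zero]
  rw [hI, hker w hne.symm, ← hgω, smul_eq_mul, ← mul_sub, mul_left_comm, inv_mul_cancel_left₀ hπ,
    ← neg_sub ω w, inv_neg]
  ring

/-- The `n`th Taylor coefficient at `0`, in the variable `w`, of the analytic part
`(1 / 2πi) ∫ S(ζ) / ((Ψ(ω) - Ψ(ζ)) (ζ - w)) dζ`, `|ζ| = ρ`, of the kernel `S(w) / (Ψ(ω) - Ψ(w))`. -/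
noncomputable def smoothCoeff (Ψ S : ℂ → ℂ) (ρ : ℝ) (ω : ℂ) (n : ℕ) : ℂ :=
  (2 * π * I : ℂ)⁻¹ • ∮ ζ in C(0, ρ), (ζ ^ (n + 1))⁻¹ • (S ζ / (Ψ ω - Ψ ζ))

theorem hasSum_kernel {Ψ S : ℂ → ℂ} {R ρ : ℝ} (hΨ : DifferentiableOn ℂ Ψ (ball 0 R))
    (hinj : InjOn Ψ (ball 0 R)) (hd : ∀ w ∈ ball 0 R, deriv Ψ w ≠ 0)
    (hS : DifferentiableOn ℂ S (ball 0 R)) (hS2 : ∀ w ∈ ball 0 R, S w ^ 2 = deriv Ψ w)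
    (hρR : ρ < R) {ω w : ℂ} (hω : ‖ω‖ < ρ) (hw : ‖w‖ < ‖ω‖) :
    HasSum (fun n : ℕ => ((S ω)⁻¹ * (ω ^ (n + 1))⁻¹ + smoothCoeff Ψ S ρ ω n) * w ^ n)
      (S w / (Ψ ω - Ψ w)) := by
  have hρ0 : 0 < ρ := (norm_nonneg ω).trans_lt hω
  have hω0 : ω ≠ 0 := norm_pos_iff.1 ((norm_nonneg w).trans_lt hw)
  rw [kernel_eq_szego_add hΨ hinj hd hS hS2 hρR hω (hw.trans hω) (fun h => hw.ne (by rw [h]))]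
  simp only [add_mul]
  refine HasSum.add ?_ ?_
  · have h1 : ‖w / ω‖ < 1 := by
      rw [norm_div, div_lt_one (norm_pos_iff.2 hω0)]
      exact hw
    have h2 := (hasSum_geometric_of_norm_lt_one h1).mul_left ((S ω)⁻¹ * ω⁻¹)
    have hne : ω - w ≠ 0 := sub_ne_zero.2 fun h => hw.ne (by rw [h])
    have h3 : (S ω)⁻¹ * (ω - w)⁻¹ = (S ω)⁻¹ * ω⁻¹ * (1 - w / ω)⁻¹ := by
      rw [mul_assoc, ← mul_inv ω, mul_sub ω, mul_one, mul_div_cancel₀ _ hω0]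
    rw [h3]
    refine h2.congr_fun fun n => ?_
    rw [div_pow]
    field_simp
    ring
  · have hcs : ContinuousOn (fun ζ => S ζ / (Ψ ω - Ψ ζ)) (sphere 0 ρ) := by
      have hsub : sphere (0 : ℂ) ρ ⊆ ball 0 R :=
        sphere_subset_closedBall.trans (closedBall_subset_ball hρR)
      refine (hS.continuousOn.mono hsub).div
        (continuousOn_const.sub (hΨ.continuousOn.mono hsub)) fun ζ hζ h => ?_
      have := hinj (by simpa using hω.trans hρR) (hsub hζ) (sub_eq_zero.1 h)
      rw [mem_sphere_zero_iff_norm, ← this] at hζ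
      exact hω.ne hζ
    have h1 := (hasSum_two_pi_I_cauchyPowerSeries_integral (hcs.circleIntegrable hρ0.le)
      (hw.trans hω)).const_smul ((2 * π * I : ℂ)⁻¹)
    simp only [sub_zero, zero_add] at h1
    refine h1.congr_fun fun n => ?_
    rw [smoothCoeff, smul_mul_assoc, mul_comm _ (w ^ n), ← circleIntegral.integral_const_mul]
    congr 1
    refine circleIntegral.integral_congr hρ0.le fun ζ hζ => ?_
    simp only [smul_eq_mul, div_pow, pow_succ, mul_inv]
    ring

theorem norm_smoothCoeff_le {Ψ S : ℂ → ℂ} {ρ : ℝ} (hρ : 0 < ρ) {ω : ℂ} {M : ℝ}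
    (hM : ∀ ζ ∈ sphere (0 : ℂ) ρ, ‖S ζ / (Ψ ω - Ψ ζ)‖ ≤ M) (n : ℕ) :
    ‖smoothCoeff Ψ S ρ ω n‖ ≤ M * ρ⁻¹ ^ n := by
  refine (circleIntegral.norm_two_pi_i_inv_smul_integral_le_of_norm_le_const hρ.le
    (C := (ρ ^ (n + 1))⁻¹ * M) fun ζ hζ => ?_).trans_eq ?_
  · rw [norm_smul, norm_inv, norm_pow, mem_sphere_zero_iff_norm.1 hζ]
    exact mul_le_mul_of_nonneg_left (hM ζ hζ) (by positivity)
  · rw [pow_succ, inv_pow]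
    field_simp

theorem continuous_smoothCoeff {Ψ S : ℂ → ℂ} {R ρ : ℝ} (hΨ : DifferentiableOn ℂ Ψ (ball 0 R))
    (hinj : InjOn Ψ (ball 0 R)) (hS : DifferentiableOn ℂ S (ball 0 R)) (hρR : ρ < R)
    {ω : ℝ → ℂ} (hωc : Continuous ω) (hω : ∀ t, ‖ω t‖ < ρ) (n : ℕ) :
    Continuous fun t => smoothCoeff Ψ S ρ (ω t) n := by
  have hρ0 : 0 < ρ := (norm_nonneg _).trans_lt (hω 0)
  have hmem : ∀ t, circleMap 0 ρ t ∈ ball (0 : ℂ) R := fun t => by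
    simpa [abs_of_pos hρ0] using hρR
  have hmem' : ∀ t, ω t ∈ ball (0 : ℂ) R := fun t => by simpa using (hω t).trans hρR
  have c1 : Continuous fun t => Ψ (circleMap 0 ρ t) :=
    hΨ.continuousOn.comp_continuous (continuous_circleMap _ _) hmem
  have c2 : Continuous fun t => S (circleMap 0 ρ t) :=
    hS.continuousOn.comp_continuous (continuous_circleMap _ _) hmem
  have c3 : Continuous fun t => Ψ (ω t) := hΨ.continuousOn.comp_continuous hωc hmem'
  have c4 := continuous_circleMap (0 : ℂ) ρ
  simp only [smoothCoeff, circleIntegral, deriv_circleMap]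
  have c4' := c4.comp (continuous_snd (X := ℝ) (Y := ℝ))
  have key := intervalIntegral.continuous_parametric_intervalIntegral_of_continuous' (μ := volume)
    (f := fun t θ => (circleMap 0 ρ θ * I) • ((circleMap 0 ρ θ ^ (n + 1))⁻¹ •
      (S (circleMap 0 ρ θ) / (Ψ (ω t) - Ψ (circleMap 0 ρ θ))))) ((c4'.mul continuous_const).smul
        (((c4'.pow (n + 1)).inv₀ fun p => ?_).smul ((c2.comp continuous_snd).div
          ((c3.comp continuous_fst).sub (c1.comp continuous_snd)) fun p h => ?_))) 0 (2 * π)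
  · simp only [smul_eq_mul] at key ⊢
    exact continuous_const.mul key
  · exact pow_ne_zero _ (circleMap_ne_center hρ0.ne')
  · have := hinj (hmem' p.1) (hmem p.2) (sub_eq_zero.1 h)
    have h2 := hω p.1
    rw [this, norm_circleMap_zero, abs_of_pos hρ0] at h2
    exact lt_irrefl _ h2

/-! ### Square-integrable functions on the parameter interval -/

theorem exists_norm_le_of_continuous {h : ℝ → ℂ} (hh : Continuous h) :
    ∃ B, 0 ≤ B ∧ ∀ t ∈ Ioc 0 (2 * π), ‖h t‖ ≤ B := by
  obtain ⟨B, hB⟩ := (isCompact_Icc (a := (0 : ℝ)) (b := 2 * π)).exists_bound_of_continuousOn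
    hh.continuousOn
  exact ⟨B, (norm_nonneg _).trans (hB 0 ⟨le_rfl, by positivity⟩),
    fun t ht => hB t ⟨ht.1.le, ht.2⟩⟩

theorem memLp_two_of_continuous {h : ℝ → ℂ} (hh : Continuous h) :
    MemLp h 2 (volume.restrict (Ioc 0 (2 * π))) := by
  obtain ⟨B, -, hB⟩ := exists_norm_le_of_continuous hh
  exact MemLp.of_bound hh.aestronglyMeasurable B
    ((ae_restrict_iff' measurableSet_Ioc).2 (Eventually.of_forall hB))

/-- Multiplication by a continuous function is bounded on `L²`. -/
theorem exists_mul_continuous_bound {h : ℝ → ℂ} (hh : Continuous h) :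
    ∃ B, 0 ≤ B ∧ ∀ F : ℝ → ℂ, MemLp F 2 (volume.restrict (Ioc 0 (2 * π))) →
      MemLp (fun t => F t * h t) 2 (volume.restrict (Ioc 0 (2 * π))) ∧
      (eLpNorm (fun t => F t * h t) 2 (volume.restrict (Ioc 0 (2 * π)))).toReal ≤
        B * (eLpNorm F 2 (volume.restrict (Ioc 0 (2 * π)))).toReal := by
  obtain ⟨B, hB0, hB⟩ := exists_norm_le_of_continuous hh
  refine ⟨B, hB0, fun F hF => ?_⟩
  have hae : ∀ᵐ t ∂(volume.restrict (Ioc 0 (2 * π))), ‖F t * h t‖ ≤ B * ‖F t‖ := by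
    refine (ae_restrict_iff' measurableSet_Ioc).2 (Eventually.of_forall fun t ht => ?_)
    rw [norm_mul, mul_comm]
    exact mul_le_mul_of_nonneg_right (hB t ht) (norm_nonneg _)
  have hle := eLpNorm_le_mul_eLpNorm_of_ae_le_mul hae 2
  have hlt := ENNReal.mul_lt_top ENNReal.ofReal_lt_top hF.2 (a := ENNReal.ofReal B)
  refine ⟨⟨hF.1.mul hh.aestronglyMeasurable, hle.trans_lt hlt⟩, ?_⟩
  have := ENNReal.toReal_mono hlt.ne hle
  rwa [ENNReal.toReal_mul, ENNReal.toReal_ofReal hB0] at this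

theorem integral_zpow_mul_eq_zero {ω : ℝ → ℂ} {p : ℝ → ℝ} (hp : Continuous p)
    (hω : ∀ t, HasDerivAt ω (I * p t * ω t) t) (h1 : ∀ t, ω t ≠ 0) (hper : ω (2 * π) = ω 0)
    {m : ℤ} (hm : m ≠ 0) : ∫ t in Ioc 0 (2 * π), ω t ^ m * p t = 0 := by
  have hωc : Continuous ω := continuous_iff_continuousAt.2 fun t => (hω t).continuousAt
  have hd : ∀ t, HasDerivAt (fun t => ω t ^ m) ((m * I) * (ω t ^ m * p t)) t := fun t => by
    have := (hasDerivAt_zpow m (ω t) (Or.inl (h1 t))).comp t (hω t)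
    refine this.congr_deriv ?_
    rw [zpow_sub_one₀ (h1 t)]
    have := h1 t
    field_simp
  have hc : Continuous fun t => ω t ^ m * p t :=
    (hωc.zpow₀ m fun t => Or.inl (h1 t)).mul (Complex.continuous_ofReal.comp hp)
  have hI := intervalIntegral.integral_eq_sub_of_hasDerivAt (fun t _ => hd t)
    ((continuous_const.mul hc).intervalIntegrable 0 (2 * π))
  rw [hper, sub_self, intervalIntegral.integral_const_mul,
    intervalIntegral.integral_of_le (by positivity)] at hI
  exact (mul_eq_zero.1 hI).resolve_left (by simpa using hm)

/-- If `ω` is a closed curve on the unit circle with nowhere vanishing angular speed `p`, then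
integration against the negative powers of `ω` maps `L²` boundedly to `ℓ²`: the powers of `ω` are
orthogonal with respect to `|p| dt`, and Bessel's inequality applies. -/
theorem exists_bessel_bound {ω : ℝ → ℂ} {p : ℝ → ℝ} (hp : Continuous p) (hp0 : ∀ t, p t ≠ 0)
    (hω : ∀ t, HasDerivAt ω (I * p t * ω t) t) (h1 : ∀ t, ‖ω t‖ = 1) (hper : ω (2 * π) = ω 0)
    {h : ℝ → ℂ} (hh : Continuous h) :
    ∃ C, 0 ≤ C ∧ ∀ F : ℝ → ℂ, MemLp F 2 (volume.restrict (Ioc 0 (2 * π))) → ∀ s : Finset ℕ,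
      ∑ n ∈ s, ‖∫ t in Ioc 0 (2 * π), F t * (h t * (ω t ^ (n + 1))⁻¹)‖ ^ 2 ≤
        (C * (eLpNorm F 2 (volume.restrict (Ioc 0 (2 * π)))).toReal) ^ 2 := by
  have hω0 : ∀ t, ω t ≠ 0 := fun t => norm_pos_iff.1 (by rw [h1 t]; exact one_pos)
  have hωc : Continuous ω := continuous_iff_continuousAt.2 fun t => (hω t).continuousAt
  -- `p` has constant sign `σ`, so integrals against `|p|` are integrals against `p`.
  obtain ⟨σ, hσ⟩ : ∃ σ : ℝ, ∀ t, |p t| = σ * p t := by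
    by_cases hneg : ∃ a, p a ≤ 0
    · refine ⟨-1, fun t => ?_⟩
      have : p t < 0 := by
        by_contra! ht
        obtain ⟨x, hx⟩ := mem_range_of_exists_le_of_exists_ge hp hneg ⟨t, ht⟩
        exact hp0 x hx
      rw [abs_of_neg this, neg_one_mul]
    · push Not at hneg
      exact ⟨1, fun t => by rw [abs_of_pos (hneg t), one_mul]⟩
  -- `E n = ω ^ (n + 1) (|p| / P) ^ (1/2)` is an orthonormal system.
  set P := ∫ t in Ioc 0 (2 * π), |p t| with hP
  have hP0 : 0 < P := by
    rw [hP, ← intervalIntegral.integral_of_le (by positivity)]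
    exact intervalIntegral.intervalIntegral_pos_of_pos_on (hp.abs.intervalIntegrable _ _)
      (fun t _ => abs_pos.2 (hp0 t)) (by positivity)
  set q : ℝ → ℝ := fun t => √(|p t| / P) with hq
  have hqc : Continuous q := (hp.abs.div_const P).sqrt
  have hq0 : ∀ t, q t ≠ 0 := fun t =>
    (Real.sqrt_pos.2 (div_pos (abs_pos.2 (hp0 t)) hP0)).ne'
  have hq2 : ∀ t, q t * q t = |p t| / P := fun t => Real.mul_self_sqrt (by positivity)
  set E : ℕ → ℝ → ℂ := fun n t => ω t ^ (n + 1) * q t with hE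
  have hEc : ∀ n, Continuous (E n) := fun n =>
    (hωc.pow _).mul (Complex.continuous_ofReal.comp hqc)
  have hconj : ∀ t, conj (ω t) = (ω t)⁻¹ := fun t => by
    rw [Complex.inv_def, Complex.normSq_eq_norm_sq, h1 t]
    simp
  have horth : Orthonormal ℂ fun n => (memLp_two_of_continuous (hEc n)).toLp (E n) := by
    rw [orthonormal_iff_ite]
    intro i j
    rw [L2.inner_def]
    have e1 : ∫ t in Ioc 0 (2 * π), inner ℂ ((memLp_two_of_continuous (hEc i)).toLp (E i) t)
        ((memLp_two_of_continuous (hEc j)).toLp (E j) t) =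
        ∫ t in Ioc 0 (2 * π), (σ / P : ℂ) * (ω t ^ ((j : ℤ) - i) * p t) := by
      refine integral_congr_ae ?_
      filter_upwards [(memLp_two_of_continuous (hEc i)).coeFn_toLp,
        (memLp_two_of_continuous (hEc j)).coeFn_toLp] with t hi hj
      rw [hi, hj, RCLike.inner_apply, hE]
      simp only [map_mul, map_pow, hconj, Complex.conj_ofReal]
      have hz : ω t ^ ((j : ℤ) - i) = ω t ^ (j + 1) * (ω t)⁻¹ ^ (i + 1) := by
        rw [zpow_sub₀ (hω0 t), zpow_natCast, zpow_natCast, inv_pow]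
        have := hω0 t
        field_simp
        ring
      have hqq : (q t : ℂ) * q t = σ / P * p t := by
        rw [← Complex.ofReal_mul, hq2 t, hσ t]
        push_cast
        ring
      rw [hz]
      linear_combination ω t ^ (j + 1) * (ω t)⁻¹ ^ (i + 1) * hqq
    rw [e1, integral_const_mul]
    split_ifs with hij
    · have e2 : ∫ t in Ioc 0 (2 * π), ω t ^ ((j : ℤ) - i) * p t =
          ((∫ t in Ioc 0 (2 * π), p t : ℝ) : ℂ) := by
        rw [← integral_complex_ofReal]
        simp [hij]
      have e3 : P = σ * ∫ t in Ioc 0 (2 * π), p t := by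
        rw [hP, ← integral_const_mul]
        simp only [hσ]
      rw [e2, div_mul_eq_mul_div, ← Complex.ofReal_mul, ← e3, div_self]
      exact_mod_cast hP0.ne'
    · rw [integral_zpow_mul_eq_zero hp hω hω0 hper, mul_zero]
      intro h
      exact hij (by omega)
  obtain ⟨C, hC0, hC⟩ := exists_mul_continuous_bound (h := fun t => h t * (q t : ℂ)⁻¹)
    (hh.mul ((Complex.continuous_ofReal.comp hqc).inv₀ fun t => by simpa using hq0 t))
  refine ⟨C, hC0, fun F hF s => ?_⟩
  obtain ⟨hH, hHn⟩ := hC F hF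
  refine le_trans (le_of_eq ?_) ((horth.sum_inner_products_le (hH.toLp _) (s := s)).trans ?_)
  · refine Finset.sum_congr rfl fun n _ => ?_
    rw [L2.inner_def]
    congr 2
    refine integral_congr_ae ?_
    filter_upwards [(memLp_two_of_continuous (hEc n)).coeFn_toLp, hH.coeFn_toLp] with t hn hHt
    rw [hn, hHt, RCLike.inner_apply, hE]
    simp only [map_mul, map_pow, hconj, Complex.conj_ofReal]
    have : (q t : ℂ) ≠ 0 := by exact_mod_cast hq0 t
    rw [inv_pow]
    field_simp
  · rw [Lp.norm_toLp]
    exact pow_le_pow_left₀ ENNReal.toReal_nonneg hHn 2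

theorem norm_integral_mul_le {F g : ℝ → ℂ} (hF : MemLp F 2 (volume.restrict (Ioc 0 (2 * π))))
    {B : ℝ} (hB0 : 0 ≤ B) (hB : ∀ t, ‖g t‖ ≤ B) :
    ‖∫ t in Ioc 0 (2 * π), F t * g t‖ ≤
      B * (√(2 * π) * (eLpNorm F 2 (volume.restrict (Ioc 0 (2 * π)))).toReal) := by
  have hF1 : Integrable F (volume.restrict (Ioc 0 (2 * π))) := hF.integrable (by norm_num)
  have h1 : ∫ t in Ioc 0 (2 * π), ‖F t‖ ≤
      √(2 * π) * (eLpNorm F 2 (volume.restrict (Ioc 0 (2 * π)))).toReal := by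
    have hle := eLpNorm_le_eLpNorm_mul_rpow_measure_univ (p := 1) (q := 2) (by norm_num) hF.1
    have h2 := ENNReal.toReal_mono (ENNReal.mul_ne_top hF.2.ne
      (ENNReal.rpow_ne_top_of_nonneg (by norm_num) (measure_ne_top _ _))) hle
    rw [integral_norm_eq_lintegral_enorm hF.1, ← eLpNorm_one_eq_lintegral_enorm]
    refine h2.trans_eq ?_
    rw [ENNReal.toReal_mul, mul_comm]
    congr 1
    rw [Measure.restrict_apply_univ, Real.volume_Ioc, sub_zero, Real.sqrt_eq_rpow,
      ← ENNReal.toReal_rpow, ENNReal.toReal_ofReal (by positivity)]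
    norm_num
  calc _ ≤ ∫ t in Ioc 0 (2 * π), B * ‖F t‖ := by
        refine norm_integral_le_of_norm_le (hF1.norm.const_mul B) (Eventually.of_forall fun t => ?_)
        rw [norm_mul, mul_comm]
        exact mul_le_mul_of_nonneg_right (hB t) (norm_nonneg _)
    _ ≤ _ := by
        rw [integral_const_mul]
        gcongr

/-! ### The Cauchy integral operator -/

namespace IsAnalyticParametrization

variable {k : ℂ → ℂ}

theorem continuousOn (hk : IsAnalyticParametrization k) : ContinuousOn k (sphere 0 1) := by
  obtain ⟨U, -, hsU, hkU, -⟩ := hk.exists_conformal_nhd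
  exact hkU.continuousOn.mono hsU

theorem continuousOn_deriv (hk : IsAnalyticParametrization k) :
    ContinuousOn (deriv k) (sphere 0 1) := by
  obtain ⟨U, hU, hsU, hkU, -⟩ := hk.exists_conformal_nhd
  exact (hkU.deriv hU).continuousOn.mono hsU

theorem continuous_comp_circleMap (hk : IsAnalyticParametrization k) :
    Continuous fun t => k (circleMap 0 1 t) :=
  hk.continuousOn.comp_continuous (continuous_circleMap 0 1) (circleMap_mem_sphere 0 zero_le_one)

theorem continuous_deriv_comp_circleMap (hk : IsAnalyticParametrization k) :
    Continuous fun t => deriv k (circleMap 0 1 t) :=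
  hk.continuousOn_deriv.comp_continuous (continuous_circleMap 0 1)
    (circleMap_mem_sphere 0 zero_le_one)

/-- The image of Lebesgue measure `dt` is dominated by arc length, as the speed is bounded below. -/
theorem exists_map_le_smul_arcLength (hk : IsAnalyticParametrization k) :
    ∃ a : ENNReal, a ≠ ⊤ ∧
      (volume.restrict (Ioc 0 (2 * π))).map (fun t => k (circleMap 0 1 t)) ≤ a • arcLength k := by
  obtain ⟨U, hU, hsU, hkU, hk0⟩ := hk.exists_conformal_nhd
  obtain ⟨b, hb, hbk⟩ := (isCompact_sphere (0 : ℂ) 1).exists_forall_le' (a := 0)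
    hk.continuousOn_deriv.norm fun u hu => norm_pos_iff.2 (hk0 u (hsU hu))
  set μ := volume.restrict (Ioc 0 (2 * π)) with hμ
  set d : ℝ → ENNReal := fun t => ENNReal.ofReal ‖deriv k (circleMap 0 1 t)‖ with hd
  have hb0 : ENNReal.ofReal b ≠ 0 := by simpa using hb
  have h1 : μ ≤ (ENNReal.ofReal b)⁻¹ • μ.withDensity d := by
    have h2 : ENNReal.ofReal b • μ ≤ μ.withDensity d := by
      rw [← withDensity_const]
      exact withDensity_mono (Eventually.of_forall fun t => ENNReal.ofReal_le_ofReal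
        (hbk _ (circleMap_mem_sphere 0 zero_le_one t)))
    calc μ = (ENNReal.ofReal b)⁻¹ • (ENNReal.ofReal b • μ) := by
          rw [smul_smul, ENNReal.inv_mul_cancel hb0 ENNReal.ofReal_ne_top, one_smul]
      _ ≤ _ := by gcongr
  have hc0 : ENNReal.ofReal (2 * π)⁻¹ ≠ 0 := by
    simp only [ne_eq, ENNReal.ofReal_eq_zero, not_le]
    positivity
  refine ⟨(ENNReal.ofReal b)⁻¹ * (ENNReal.ofReal (2 * π)⁻¹)⁻¹,
    ENNReal.mul_ne_top (by simpa using hb) (ENNReal.inv_ne_top.2 hc0), ?_⟩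
  have h3 := Measure.map_mono h1 hk.continuous_comp_circleMap.measurable
  rw [Measure.map_smul] at h3
  refine h3.trans_eq ?_
  rw [arcLength, smul_smul, mul_assoc, ENNReal.inv_mul_cancel hc0 ENNReal.ofReal_ne_top, mul_one]

theorem exists_memLp_comp_bound (hk : IsAnalyticParametrization k) :
    ∃ A, 0 ≤ A ∧ ∀ f : ℂ → ℂ, MemLp f 2 (arcLength k) →
      MemLp (fun t => f (k (circleMap 0 1 t))) 2 (volume.restrict (Ioc 0 (2 * π))) ∧
      (eLpNorm (fun t => f (k (circleMap 0 1 t))) 2 (volume.restrict (Ioc 0 (2 * π)))).toReal ≤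
        A * (eLpNorm f 2 (arcLength k)).toReal := by
  obtain ⟨a, ha, hle⟩ := hk.exists_map_le_smul_arcLength
  have ha' : a ^ ((1 / (2 : ENNReal)).toReal) ≠ ⊤ := ENNReal.rpow_ne_top_of_nonneg ENNReal.toReal_nonneg ha
  refine ⟨(a ^ ((1 / (2 : ENNReal)).toReal)).toReal, ENNReal.toReal_nonneg, fun f hf => ?_⟩
  have hac : (volume.restrict (Ioc 0 (2 * π))).map (fun t => k (circleMap 0 1 t)) ≪ arcLength k :=
    (Measure.absolutelyContinuous_of_le hle).trans Measure.smul_absolutelyContinuous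
  have hm := hk.continuous_comp_circleMap.measurable
  have hfm := hf.1.mono_ac hac
  have hn : eLpNorm (fun t => f (k (circleMap 0 1 t))) 2 (volume.restrict (Ioc 0 (2 * π))) ≤
      a ^ ((1 / (2 : ENNReal)).toReal) * eLpNorm f 2 (arcLength k) := by
    have h1 := eLpNorm_map_measure (p := 2) hfm hm.aemeasurable
    have h2 := eLpNorm_mono_measure (p := 2) f hle
    rw [eLpNorm_smul_measure_of_ne_top (by norm_num), smul_eq_mul, h1] at h2
    exact h2
  have hlt := ENNReal.mul_lt_top ha'.lt_top hf.2
  refine ⟨⟨hfm.comp_measurable hm, hn.trans_lt hlt⟩, ?_⟩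
  rw [← ENNReal.toReal_mul]
  exact ENNReal.toReal_mono hlt.ne hn

theorem comp_circleMap_ae_eq (hk : IsAnalyticParametrization k) {f g : ℂ → ℂ}
    (h : f =ᵐ[arcLength k] g) :
    (fun t => f (k (circleMap 0 1 t))) =ᵐ[volume.restrict (Ioc 0 (2 * π))]
      fun t => g (k (circleMap 0 1 t)) := by
  obtain ⟨a, -, hle⟩ := hk.exists_map_le_smul_arcLength
  exact ae_of_ae_map hk.continuous_comp_circleMap.measurable.aemeasurable
    (((Measure.absolutelyContinuous_of_le hle).trans Measure.smul_absolutelyContinuous).ae_le h)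

end IsAnalyticParametrization

namespace BoundaryExtension

variable {φ : RiemannMap D} {k : ℂ → ℂ} (e : BoundaryExtension φ k)

theorem continuous_param_circleMap : Continuous fun t => e.param (circleMap 0 1 t) :=
  e.differentiableOn_param.continuousOn.comp_continuous (continuous_circleMap 0 1)
    fun t => e.sphere_subset_nhd (circleMap_mem_sphere 0 zero_le_one t)

/-- The curve `t ↦ param (e ^ (it))` moves on the unit circle with a real, nowhere vanishing angular
speed, the logarithmic derivative `u θ'(u) / θ(u)` of `θ = param`. -/
theorem exists_angular_speed : ∃ p : ℝ → ℝ, Continuous p ∧ (∀ t, p t ≠ 0) ∧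
    ∀ t, HasDerivAt (fun t => e.param (circleMap 0 1 t))
      (I * p t * e.param (circleMap 0 1 t)) t := by
  set ω : ℝ → ℂ := fun t => e.param (circleMap 0 1 t) with hω
  have hs : ∀ t, circleMap 0 1 t ∈ sphere (0 : ℂ) 1 := circleMap_mem_sphere 0 zero_le_one
  have h1 : ∀ t, ‖ω t‖ = 1 := fun t => e.norm_param _ (hs t)
  have h0 : ∀ t, ω t ≠ 0 := fun t => norm_pos_iff.1 (by rw [h1 t]; exact one_pos)
  set q : ℝ → ℂ := fun t => circleMap 0 1 t * deriv e.param (circleMap 0 1 t) / ω t with hq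
  have hqc : Continuous q :=
    ((continuous_circleMap 0 1).mul ((e.differentiableOn_param.deriv e.isOpen_nhd).continuousOn
      |>.comp_continuous (continuous_circleMap 0 1) fun t => e.sphere_subset_nhd (hs t))).div
      e.continuous_param_circleMap h0
  have hd : ∀ t, HasDerivAt ω (I * q t * ω t) t := fun t => by
    have h2 := (e.differentiableOn_param.differentiableAt
      (e.isOpen_nhd.mem_nhds (e.sphere_subset_nhd (hs t)))).hasDerivAt.comp t
        (hasDerivAt_circleMap 0 1 t)
    refine h2.congr_deriv ?_
    have := h0 t
    simp only [hq]
    field_simp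
  have hre : ∀ t, ((q t).re : ℂ) = q t := fun t => by
    have h2 := (hd t).norm_sq
    have h3 : (fun t => ‖ω t‖ ^ 2) = fun _ => 1 := by
      funext t
      rw [h1 t, one_pow]
    have h4 := (h3 ▸ h2).unique (hasDerivAt_const t (1 : ℝ))
    rw [Complex.inner] at h4
    have h5 : I * q t * ω t * conj (ω t) = I * q t := by
      rw [mul_assoc, Complex.mul_conj, Complex.normSq_eq_norm_sq, h1 t]
      simp
    rw [h5] at h4
    have h6 : (q t).im = 0 := by simpa using h4
    exact Complex.ext (by simp) (by simp [h6])
  refine ⟨fun t => (q t).re, Complex.continuous_re.comp hqc, fun t ht => ?_, fun t => ?_⟩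
  · have h2 : q t = 0 := by rw [← hre t, show (q t).re = 0 from ht, Complex.ofReal_zero]
    rw [hq] at h2
    simp only [div_eq_zero_iff, mul_eq_zero] at h2
    rcases h2 with (h2 | h2) | h2
    · exact circleMap_ne_center one_ne_zero h2
    · exact e.deriv_param_ne_zero _ (hs t) h2
    · exact h0 t h2
  · rw [hre t]
    exact hd t

end BoundaryExtension

/-- The Taylor coefficients `g n`, in the variable `w = φ z`, of the Cauchy kernel divided by
`φ' ^ (1/2)`: integration against them maps `L²` boundedly to `ℓ²`. -/
theorem exists_kernel_coefficients (hD : IsOpen D) {φ : RiemannMap D} {k : ℂ → ℂ}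
    (hk : IsAnalyticParametrization k) (e : BoundaryExtension φ k) :
    ∃ g : ℕ → ℝ → ℂ, (∀ n, Continuous (g n)) ∧ (∃ B, ∀ n t, ‖g n t‖ ≤ B) ∧
      (∃ C, 0 ≤ C ∧ ∀ F : ℝ → ℂ, MemLp F 2 (volume.restrict (Ioc 0 (2 * π))) → ∀ s : Finset ℕ,
        ∑ n ∈ s, ‖∫ t in Ioc 0 (2 * π), F t * g n t‖ ^ 2 ≤
          (C * (eLpNorm F 2 (volume.restrict (Ioc 0 (2 * π)))).toReal) ^ 2) ∧
      ∀ z ∈ D, ∀ t, HasSum (fun n => g n t * φ.toFun z ^ n)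
        ((2 * π * I : ℂ)⁻¹ * (circleMap 0 1 t * I * (deriv k (circleMap 0 1 t) /
          (k (circleMap 0 1 t) - z))) * (φ.sqrtDeriv z)⁻¹) := by
  obtain ⟨S, hS, hS2, hS1⟩ := e.exists_sqrt hD
  obtain ⟨ρ, hρ1, hρR⟩ := exists_between e.one_lt_radius
  have hρ0 : 0 < ρ := by linarith
  set Ψ := e.invMap with hΨ
  set ω : ℝ → ℂ := fun t => e.param (circleMap 0 1 t) with hω
  have hs : ∀ t, circleMap 0 1 t ∈ sphere (0 : ℂ) 1 := circleMap_mem_sphere 0 zero_le_one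
  have hω1 : ∀ t, ‖ω t‖ = 1 := fun t => e.norm_param _ (hs t)
  have hωs : ∀ t, ω t ∈ sphere (0 : ℂ) 1 := fun t => by simpa using hω1 t
  have hωρ : ∀ t, ‖ω t‖ < ρ := fun t => by rw [hω1 t]; exact hρ1
  have hωc : Continuous ω := e.continuous_param_circleMap
  obtain ⟨p, hpc, hp0, hωd⟩ := e.exists_angular_speed
  have hs1R : sphere (0 : ℂ) 1 ⊆ ball 0 e.radius :=
    sphere_subset_closedBall.trans (closedBall_subset_ball e.one_lt_radius)
  have hsρR : sphere (0 : ℂ) ρ ⊆ ball 0 e.radius :=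
    sphere_subset_closedBall.trans (closedBall_subset_ball hρR)
  have hS0 : ∀ w ∈ ball (0 : ℂ) e.radius, S w ≠ 0 := fun w hw h =>
    e.deriv_invMap_ne_zero w hw (by rw [← hS2 w hw, h]; simp)
  obtain ⟨A, hA⟩ := (isCompact_sphere (0 : ℂ) 1).exists_bound_of_continuousOn
    ((hS.continuousOn.mono hs1R).inv₀ fun w hw => hS0 w (hs1R hw))
  obtain ⟨M, hM⟩ := ((isCompact_sphere (0 : ℂ) 1).prod (isCompact_sphere (0 : ℂ) ρ))
    |>.exists_bound_of_continuousOn (f := fun x : ℂ × ℂ => S x.2 / (Ψ x.1 - Ψ x.2)) (by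
      refine ContinuousOn.div ((hS.continuousOn.mono hsρR).comp continuousOn_snd fun x hx => hx.2)
        (((e.differentiableOn_invMap.continuousOn.mono hs1R).comp continuousOn_fst
          fun x hx => hx.1).sub ((e.differentiableOn_invMap.continuousOn.mono hsρR).comp
            continuousOn_snd fun x hx => hx.2)) fun x hx h => ?_
      have h1 := e.injOn_invMap (hs1R hx.1) (hsρR hx.2) (sub_eq_zero.1 h)
      have h2 := mem_sphere_zero_iff_norm.1 hx.1
      rw [h1, mem_sphere_zero_iff_norm.1 hx.2] at h2
      exact hρ1.ne' h2)
  obtain ⟨L, hL⟩ := (isCompact_sphere (0 : ℂ) 1).exists_bound_of_continuousOn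
    hk.continuousOn_deriv
  have h1s : (1 : ℂ) ∈ sphere (0 : ℂ) 1 := by simp
  have hA0 : 0 ≤ A := (norm_nonneg _).trans (hA 1 h1s)
  have hL0 : 0 ≤ L := (norm_nonneg _).trans (hL 1 h1s)
  have hM0 : 0 ≤ M := (norm_nonneg _).trans
    (hM (1, (ρ : ℂ)) ⟨h1s, by simp [abs_of_pos hρ0]⟩)
  have hπ : ‖(2 * π * I : ℂ)⁻¹‖ ≤ 1 := by
    rw [norm_inv]
    refine inv_le_one_of_one_le₀ ?_
    simp only [norm_mul, Complex.norm_ofNat, Complex.norm_real, norm_I, mul_one, Real.norm_eq_abs,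
      abs_of_pos Real.pi_pos]
    linarith [Real.pi_gt_three]
  set m : ℝ → ℂ := fun t => (2 * π * I : ℂ)⁻¹ * (circleMap 0 1 t * I * deriv k (circleMap 0 1 t))
    with hm
  have hmc : Continuous m := continuous_const.mul
    (((continuous_circleMap 0 1).mul continuous_const).mul hk.continuous_deriv_comp_circleMap)
  have hmL : ∀ t, ‖m t‖ ≤ L := fun t => by
    rw [hm]
    simp only
    rw [norm_mul, norm_mul, norm_mul, norm_circleMap_zero, norm_I, abs_one, one_mul, one_mul]
    exact (mul_le_of_le_one_left (norm_nonneg _) hπ).trans (hL _ (hs t))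
  have hSc : Continuous fun t => (S (ω t))⁻¹ :=
    (hS.continuousOn.comp_continuous hωc fun t => hs1R (hωs t)).inv₀
      fun t => hS0 _ (hs1R (hωs t))
  have hrc := fun n => continuous_smoothCoeff (Ψ := Ψ) e.differentiableOn_invMap e.injOn_invMap hS
    hρR hωc hωρ n
  have hr : ∀ n t, ‖smoothCoeff Ψ S ρ (ω t) n‖ ≤ M * ρ⁻¹ ^ n := fun n t =>
    norm_smoothCoeff_le hρ0 (fun ζ hζ => hM (ω t, ζ) ⟨hωs t, hζ⟩) n
  have hρi : ρ⁻¹ < 1 := inv_lt_one_of_one_lt₀ hρ1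
  have hρi0 : 0 < ρ⁻¹ := inv_pos.2 hρ0
  obtain ⟨C₁, hC₁0, hC₁⟩ := exists_bessel_bound hpc hp0 hωd hω1 (by simp [circleMap])
    (hmc.mul hSc)
  have hwc : ∀ n, Continuous fun t => (ω t ^ (n + 1))⁻¹ := fun n =>
    (hωc.pow _).inv₀ fun t => pow_ne_zero _ (norm_pos_iff.1 (by rw [hω1 t]; exact one_pos))
  refine ⟨fun n t => m t * ((S (ω t))⁻¹ * (ω t ^ (n + 1))⁻¹ + smoothCoeff Ψ S ρ (ω t) n),
    fun n => hmc.mul ((hSc.mul (hwc n)).add (hrc n)), ⟨L * (A + M), fun n t => ?_⟩, ?_, ?_⟩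
  · rw [norm_mul]
    refine mul_le_mul (hmL t) ((norm_add_le _ _).trans (add_le_add ?_ ?_)) (norm_nonneg _) hL0
    · rw [norm_mul, norm_inv (ω t ^ (n + 1)), norm_pow, hω1 t, one_pow, inv_one, mul_one]
      exact hA _ (hωs t)
    · exact (hr n t).trans (mul_le_of_le_one_right hM0 (pow_le_one₀ hρi0.le hρi.le))
  · set K := (1 - ρ⁻¹ ^ 2)⁻¹ with hK
    have hρ2 : ρ⁻¹ ^ 2 < 1 := pow_lt_one₀ hρi0.le hρi two_ne_zero
    have hK0 : 0 ≤ K := inv_nonneg.2 (by linarith)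
    set C₂ := L * M * √(2 * π) with hC₂
    refine ⟨√(2 * C₁ ^ 2 + 2 * (C₂ ^ 2 * K)), Real.sqrt_nonneg _, fun F hF s => ?_⟩
    set N := (eLpNorm F 2 (volume.restrict (Ioc 0 (2 * π)))).toReal with hN
    have hF1 : Integrable F (volume.restrict (Ioc 0 (2 * π))) := hF.integrable (by norm_num)
    have hint : ∀ {h : ℝ → ℂ}, Continuous h →
        Integrable (fun t => F t * h t) (volume.restrict (Ioc 0 (2 * π))) := fun {h} hh => by
      obtain ⟨B, -, hB⟩ := exists_norm_le_of_continuous hh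
      exact hF1.mul_bdd hh.aestronglyMeasurable
        ((ae_restrict_iff' measurableSet_Ioc).2 (Eventually.of_forall hB))
    have hsplit : ∀ n, ∫ t in Ioc 0 (2 * π), F t * (m t * ((S (ω t))⁻¹ * (ω t ^ (n + 1))⁻¹ +
        smoothCoeff Ψ S ρ (ω t) n)) =
        (∫ t in Ioc 0 (2 * π), F t * (m t * (S (ω t))⁻¹ * (ω t ^ (n + 1))⁻¹)) +
        ∫ t in Ioc 0 (2 * π), F t * (m t * smoothCoeff Ψ S ρ (ω t) n) := fun n => by
      rw [← integral_add (hint (h := fun t => m t * (S (ω t))⁻¹ * (ω t ^ (n + 1))⁻¹)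
        ((hmc.mul hSc).mul (hwc n)))
        (hint (h := fun t => m t * smoothCoeff Ψ S ρ (ω t) n) (hmc.mul (hrc n)))]
      congr 1
      funext t
      ring
    have hsmooth : ∀ n, ‖∫ t in Ioc 0 (2 * π), F t * (m t * smoothCoeff Ψ S ρ (ω t) n)‖ ^ 2 ≤
        (C₂ * N) ^ 2 * (ρ⁻¹ ^ 2) ^ n := fun n => by
      have h1 := norm_integral_mul_le hF (g := fun t => m t * smoothCoeff Ψ S ρ (ω t) n)
        (B := L * (M * ρ⁻¹ ^ n)) (by positivity) fun t => by
          rw [norm_mul]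
          exact mul_le_mul (hmL t) (hr n t) (norm_nonneg _) hL0
      refine (pow_le_pow_left₀ (norm_nonneg _) h1 2).trans_eq ?_
      rw [hC₂, ← pow_mul, mul_comm 2 n, pow_mul]
      ring
    have hgeom : ∑ n ∈ s, (ρ⁻¹ ^ 2) ^ n ≤ K := by
      rw [hK, ← tsum_geometric_of_lt_one (by positivity) hρ2]
      exact (summable_geometric_of_lt_one (by positivity) hρ2).sum_le_tsum s
        fun n _ => by positivity
    calc _ ≤ ∑ n ∈ s, (2 * ‖∫ t in Ioc 0 (2 * π), F t * (m t * (S (ω t))⁻¹ *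
              (ω t ^ (n + 1))⁻¹)‖ ^ 2 + 2 * ((C₂ * N) ^ 2 * (ρ⁻¹ ^ 2) ^ n)) := by
            refine Finset.sum_le_sum fun n _ => ?_
            rw [hsplit n]
            have h1 := norm_add_le (∫ t in Ioc 0 (2 * π), F t * (m t * (S (ω t))⁻¹ *
              (ω t ^ (n + 1))⁻¹)) (∫ t in Ioc 0 (2 * π), F t * (m t * smoothCoeff Ψ S ρ (ω t) n))
            have h2 := pow_le_pow_left₀ (norm_nonneg _) h1 2
            have h3 := hsmooth n
            have h4 := add_sq_le (a := ‖∫ t in Ioc 0 (2 * π), F t * (m t * (S (ω t))⁻¹ *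
              (ω t ^ (n + 1))⁻¹)‖)
              (b := ‖∫ t in Ioc 0 (2 * π), F t * (m t * smoothCoeff Ψ S ρ (ω t) n)‖)
            linarith
      _ ≤ 2 * (C₁ * N) ^ 2 + 2 * ((C₂ * N) ^ 2 * K) := by
            rw [Finset.sum_add_distrib, ← Finset.mul_sum, ← Finset.mul_sum, ← Finset.mul_sum]
            gcongr
            exact hC₁ F hF s
      _ = _ := by
            rw [mul_pow √_, Real.sq_sqrt (by positivity)]
            ring
  · intro z hz t
    have hw := φ.bijOn.mapsTo hz
    have hΨz : Ψ (φ.toFun z) = z :=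
      φ.bijOn.injOn (e.invMap_mem _ hw) hz (e.apply_invMap _ hw)
    have hSz : S (φ.toFun z) = (φ.sqrtDeriv z)⁻¹ := by
      have := hS1 _ hw
      rw [hΨz] at this
      exact eq_inv_of_mul_eq_one_left this
    have h1 := (hasSum_kernel (Ψ := Ψ) e.differentiableOn_invMap e.injOn_invMap e.deriv_invMap_ne_zero hS hS2
      hρR (hωρ t) (w := φ.toFun z) (by rw [hω1 t]; simpa using hw)).mul_left (m t)
    rw [hΨz, hSz, show Ψ (ω t) = k (circleMap 0 1 t) from e.invMap_param _ (hs t)] at h1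
    have h2 : (2 * π * I : ℂ)⁻¹ * (circleMap 0 1 t * I * (deriv k (circleMap 0 1 t) /
        (k (circleMap 0 1 t) - z))) * (φ.sqrtDeriv z)⁻¹ =
        m t * ((φ.sqrtDeriv z)⁻¹ / (k (circleMap 0 1 t) - z)) := by
      simp only [hm, div_eq_mul_inv]
      ring
    rw [h2]
    simpa only [mul_assoc] using h1

/-- The Cauchy integral of `f` is the element of `E²(D)` whose Hardy space representative has the
Taylor coefficients `∫ f(k(e ^ (it))) g n t dt`. -/
theorem exists_cauchyIntegral_operator (hD_open : IsOpen D) (hD_bdd : Bornology.IsBounded D)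
    {k : ℂ → ℂ} (hk : IsAnalyticParametrization k)
    (hkD : frontier D = k '' sphere 0 1) (φ : RiemannMap D) :
    ∃ C : Lp ℂ 2 (arcLength k) →L[ℂ] SmirnovClass φ,
      ∀ (f : Lp ℂ 2 (arcLength k)) (z : D),
        CircleIntegrable (cauchyIntegrand k f z) 0 1 ∧ C f z = cauchyIntegral k f z := by
  obtain ⟨e⟩ := exists_boundaryExtension hD_open hD_bdd φ hk hkD
  obtain ⟨g, hgc, ⟨B, hB⟩, ⟨C, hC0, hC⟩, hg⟩ := exists_kernel_coefficients hD_open hk e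
  obtain ⟨A, hA0, hA⟩ := hk.exists_memLp_comp_bound
  set μ := volume.restrict (Ioc 0 (2 * π)) with hμ
  have hF : ∀ f : Lp ℂ 2 (arcLength k), MemLp (fun t => f (k (circleMap 0 1 t))) 2 μ := fun f =>
    (hA f (Lp.memLp f)).1
  have hF1 : ∀ f : Lp ℂ 2 (arcLength k), Integrable (fun t => f (k (circleMap 0 1 t))) μ :=
    fun f => (hF f).integrable (by norm_num)
  have hint : ∀ (f : Lp ℂ 2 (arcLength k)) (n : ℕ),
      Integrable (fun t => f (k (circleMap 0 1 t)) * g n t) μ := fun f n =>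
    (hF1 f).mul_bdd (hgc n).aestronglyMeasurable (Eventually.of_forall (hB n))
  have hsum : ∀ (f : Lp ℂ 2 (arcLength k)) (s : Finset ℕ),
      ∑ n ∈ s, ‖∫ t, f (k (circleMap 0 1 t)) * g n t ∂μ‖ ^ (2 : ENNReal).toReal ≤
        (C * A * ‖f‖) ^ (2 : ENNReal).toReal := fun f s => by
    have h1 := hC _ (hF f) s
    have h2 := mul_le_mul_of_nonneg_left (hA f (Lp.memLp f)).2 hC0
    have h3 := pow_le_pow_left₀ (mul_nonneg hC0 ENNReal.toReal_nonneg) h2 2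
    rw [Lp.norm_def, mul_assoc]
    simpa using h1.trans h3
  let T : Lp ℂ 2 (arcLength k) →ₗ[ℂ] HardySpace :=
    { toFun := fun f => ⟨fun n => ∫ t, f (k (circleMap 0 1 t)) * g n t ∂μ, memℓp_gen' (hsum f)⟩
      map_add' := fun f₁ f₂ => by
        ext n
        change ∫ t, (f₁ + f₂ : Lp ℂ 2 (arcLength k)) (k (circleMap 0 1 t)) * g n t ∂μ =
          (∫ t, f₁ (k (circleMap 0 1 t)) * g n t ∂μ) + ∫ t, f₂ (k (circleMap 0 1 t)) * g n t ∂μ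
        rw [← integral_add (hint f₁ n) (hint f₂ n)]
        refine integral_congr_ae ?_
        filter_upwards [hk.comp_circleMap_ae_eq (Lp.coeFn_add f₁ f₂)] with t ht
        rw [ht, Pi.add_apply, add_mul]
      map_smul' := fun c f => by
        ext n
        change ∫ t, (c • f : Lp ℂ 2 (arcLength k)) (k (circleMap 0 1 t)) * g n t ∂μ =
          c * ∫ t, f (k (circleMap 0 1 t)) * g n t ∂μ
        rw [← integral_const_mul]
        refine integral_congr_ae ?_
        filter_upwards [hk.comp_circleMap_ae_eq (Lp.coeFn_smul c f)] with t ht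
        rw [ht, Pi.smul_apply, smul_eq_mul, mul_assoc] }
  refine ⟨((SmirnovClass.ofHardy φ).toLinearMap ∘ₗ T).mkContinuous (C * A) fun f => ?_,
    fun f z => ?_⟩
  · change ‖SmirnovClass.ofHardy φ (T f)‖ ≤ _
    rw [SmirnovClass.norm_ofHardy]
    exact lp.norm_le_of_forall_sum_le (by norm_num) (by positivity) (hsum f)
  have hz : ∀ t, k (circleMap 0 1 t) - z ≠ 0 := fun t h => by
    have h1 : k (circleMap 0 1 t) ∈ frontier D :=
      hkD ▸ mem_image_of_mem k (circleMap_mem_sphere 0 zero_le_one t)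
    rw [hD_open.frontier_eq, sub_eq_zero.1 h] at h1
    exact h1.2 z.2
  have hsq : φ.sqrtDeriv z ≠ 0 := fun h => φ.deriv_ne_zero z z.2 (by
    rw [← φ.sq_sqrtDeriv z z.2, h]; simp)
  refine ⟨?_, ?_⟩
  · have hc : Continuous fun t => deriv k (circleMap 0 1 t) / (k (circleMap 0 1 t) - z) :=
      hk.continuous_deriv_comp_circleMap.div (hk.continuous_comp_circleMap.sub continuous_const) hz
    obtain ⟨b, -, hb⟩ := exists_norm_le_of_continuous hc
    rw [circleIntegrable_def, intervalIntegrable_iff_integrableOn_Ioc_of_le (by positivity)]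
    refine ((hF1 f).mul_bdd hc.aestronglyMeasurable ((ae_restrict_iff' measurableSet_Ioc).2
      (Eventually.of_forall hb))).congr (Eventually.of_forall fun t => ?_)
    simp only [cauchyIntegrand]
    ring
  · change SmirnovClass.ofHardy φ (T f) z = _
    rw [SmirnovClass.ofHardy_apply]
    have hw : ‖φ.toFun z‖ < 1 := by simpa using φ.bijOn.mapsTo z.2
    have h1 : HasSum (fun n => ∫ t, f (k (circleMap 0 1 t)) * g n t * φ.toFun z ^ n ∂μ)
        (∫ t, f (k (circleMap 0 1 t)) * ((2 * π * I : ℂ)⁻¹ * (circleMap 0 1 t * I *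
          (deriv k (circleMap 0 1 t) / (k (circleMap 0 1 t) - z))) * (φ.sqrtDeriv z)⁻¹) ∂μ) := by
      refine hasSum_integral_of_dominated_convergence
        (fun n t => ‖f (k (circleMap 0 1 t))‖ * (B * ‖φ.toFun z‖ ^ n))
        (fun n => ((hint f n).mul_const _).1) (fun n => Eventually.of_forall fun t => ?_)
        (Eventually.of_forall fun t => ?_) ?_ (Eventually.of_forall fun t => ?_)
      · rw [norm_mul, norm_mul, norm_pow, mul_assoc]
        gcongr
        exact hB n t
      · exact ((summable_geometric_of_lt_one (norm_nonneg _) hw).mul_left B).mul_left _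
      · simp only [tsum_mul_left]
        exact (hF1 f).norm.mul_const _
      · simp only [mul_assoc]
        have := (hg z z.2 t).mul_left (f (k (circleMap 0 1 t)))
        simpa only [mul_assoc] using this
    have h2 : (T f).eval (φ.toFun z) = cauchyIntegral k f z * (φ.sqrtDeriv z)⁻¹ := by
      refine ((T f).hasSum_eval (φ.bijOn.mapsTo z.2)).unique ?_
      convert h1 using 1
      · funext n
        rw [integral_mul_const]
        rfl
      · rw [cauchyIntegral, circleIntegral, intervalIntegral.integral_of_le (by positivity),
          mul_assoc, ← integral_mul_const, ← integral_const_mul]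
        refine integral_congr_ae (Eventually.of_forall fun t => ?_)
        simp only [deriv_circleMap, cauchyIntegrand, smul_eq_mul]
        ring
    rw [h2, inv_mul_cancel_right₀ hsq]

end

theorem theorem1 (D : Set ℂ) (hD_open : IsOpen D) (hD_bdd : Bornology.IsBounded D)
    (hD_sc : IsSimplyConnected D) (k : ℂ → ℂ) (hk : IsAnalyticParametrization k)
    (hkD : frontier D = k '' sphere 0 1) (φ : RiemannMap D) :
    ∃ C : Lp ℂ 2 (arcLength k) →L[ℂ] SmirnovClass φ,
      ∀ (f : Lp ℂ 2 (arcLength k)) (z : D),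
        CircleIntegrable (cauchyIntegrand k f z) 0 1 ∧ C f z = cauchyIntegral k f z :=
  exists_cauchyIntegral_operator hD_open hD_bdd hk hkD φ
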